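/- Let $(\Omega,\mathcal F,\mathbb P)$ be a probability space and $\mathfrak H$ a separable real Hilbert space. Measurability of a random variable with respect to a sub-$\sigma$-field always means measurability with respect to its completion. Let $X=\{X(f):f\in\mathfrak H\}$ be a family of centered, square integrable real random variables with $\mathbb E[X(f)X(g)]=(f,g)_{\mathfrak H}$ for all $f,g\in\mathfrak H$. *Resolutions.* Let $\mathcal R_X(\mathfrak H)$ be the class of families $\pi=\{\pi_t:t\in[0,1]\}$ of orthogonal projections of $\mathfrak H$ such that $\pi_0=0$, $\pi_1=\mathrm{id}$, $\pi_s\mathfrak H\subseteq\pi_t\mathfrak H$ for $s<t$, $t\mapsto\pi_t h$ is continuous for every $h\in\mathfrak H$, and, for all $m\ge 2$, $h_1,\dots,h_m\in\mathfrak H$ and $0\le t_0<t_1<\dots<t_m\le 1$, the random variables $X((\pi_{t_i}-\pi_{t_{i-1}})h_i)$, $i=1,\dots,m$, are jointly independent. For $\pi\in\mathcal R_X(\mathfrak H)$ put $\mathcal F_t^\pi(X)=\sigma\{X(\pi_tf):f\in\mathfrak H\}$. For a closed subspace $\mathfrak H^*\subseteq\mathfrak H$, let $\pi_{\le t}\mathfrak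 H^*$ be the closed linear span of $\{\pi_sf:f\in\mathfrak H^*,\ s\le t\}$. *Integrands and integrals.* $L^2_\pi(\mathfrak H,\mathfrak H^*,X)$ is the closure, in the space of square integrable $\mathfrak H$-valued random variables, of the linear span of the variables $\Psi\,(\pi_{t_2}-\pi_{t_1})g$, where $0\le t_1<t_2\le 1$, $g\in\mathfrak H^*$ and $\Psi$ is square integrable and $\sigma\{X(f):f\in\pi_{\le t_1}\mathfrak H^*\}$-measurable. $J_X^\pi$ is the continuous linear extension, to the $L^2$-closure of the span of its elementary integrands, of the map $\Phi\,(\pi_{t_2}-\pi_{t_1})f\mapsto \Phi\, X((\pi_{t_2}-\pi_{t_1})f)$, where $0\le t_1<t_2\le 1$, $f\in\mathfrak H$ and $\Phi$ is square integrable and $\mathcal F_{t_1}^\pi(X)$-measurable; it takes values in $L^2(\mathbb P)$. *Exponents.* If $\mathcal R_X(\mathfrak H)\ne\varnothing$, then for every $h\in\mathfrak H$ there is a unique pair $(c^2(h),\nu_h)$, where $c^2(h)\ge 0$ and $\nu_h$ is a measure on $\mathbb R$ with $\nu_h(\{0\})=0$, $\int(x^2\wedge1)\,\nu_h(dx)<\infty$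 and $\int_{|x|\ge1}x^2\,\nu_h(dx)<\infty$, such that $\mathbb E[e^{i\lambda X(h)}]=\exp[\psi_{\mathfrak H}(h;\lambda)]$ for all $\lambda\in\mathbb R$, with $$\psi_{\mathfrak H}(h;\lambda)=-\frac{c^2(h)\lambda^2}{2}+\int_{\mathbb R}\left(e^{i\lambda x}-1-i\lambda x\right)\nu_h(dx).$$ *Random characteristic functions.* A random probability is a family $\mu=\{\mu(C,\omega)\}$ such that $\mu(C,\cdot)$ is a random variable for every Borel set $C\subseteq\mathbb R$ and $\mu(\cdot,\omega)$ is a probability measure on $\mathbb R$ for a.e. $\omega$; $\widehat\mu(\lambda)(\omega)=\int e^{i\lambda x}\mu(dx,\omega)$ (and $1$ if $\mu(\cdot,\omega)$ is not a probability measure). $\widehat{\mathbf M}_0$ is the class of measurable maps $\phi:\mathbb R\times\Omega\to\mathbb C$ for which there is a random probability $\mu$ such that, for a.e. $\omega$, $\phi(\lambda,\omega)=\widehat\mu(\lambda)(\omega)$ for all $\lambda$, and such that, for a.e. $\omega$, $\phi(\lambda,\omega)\neq0$ for all $\lambda$. **Theorem.** For every $n\ge1$ let $\mathfrak H^{(n)}$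 be a closed subspace of $\mathfrak H$, $\pi^{(n)}\in\mathcal R_X(\mathfrak H)$ and $u_n\in L^2_{\pi^{(n)}}(\mathfrak H,\mathfrak H^{(n)},X)$. Suppose that there are $t_n\in[0,1]$ and closed subspaces $\mathfrak U_n$ of $\mathfrak H$, $n\ge1$, such that $$\lim_{n\to\infty}\mathbb E\left[\|\pi^{(n)}_{t_n}u_n\|^2_{\mathfrak H}\right]=0\quad\text{and}\quad \mathfrak U_n\subseteq\mathfrak U_{n+1}\cap\pi^{(n)}_{\le t_n}\mathfrak H^{(n)},\quad n\ge1.$$ Let $\mathcal U^*=\bigvee_n\sigma\{X(f):f\in\mathfrak U_n\}$. Suppose that, for some $\phi\in\widehat{\mathbf M}_0$ such that $\phi(\lambda)$ is $\mathcal U^*$-measurable for every $\lambda\in\mathbb R$, $$\exp[\psi_{\mathfrak H}(u_n;\lambda)]\to\phi(\lambda)\quad\text{in probability, for every }\lambda\in\mathbb R.$$ Then, as $n\to\infty$, $$\mathbb E\left[\exp\left(i\lambda J_X^{\pi^{(n)}}(u_n)\right)\,\middle|\,\sigma\{X(f):f\in\pi^{(n)}_{\le t_n}\mathfrak H^{(n)}\}\right]\to\phi(\lambda)\quad\text{in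 probability, for every }\lambda\in\mathbb R,$$ and, for every random probability $\mu$ such that, for a.e. $\omega$, $\phi(\lambda,\omega)=\widehat\mu(\lambda)(\omega)$ for all $\lambda$, the sequence $J_X^{\pi^{(n)}}(u_n)$ converges $\mathcal U^*$-stably to the mixture $\mathbb E\mu(\cdot)$, that is, for every $\lambda\in\mathbb R$ and every bounded $\mathcal U^*$-measurable random variable $Z$, $$\lim_{n\to\infty}\mathbb E\left[Z\exp\left(i\lambda J_X^{\pi^{(n)}}(u_n)\right)\right]=\mathbb E\left[Z\,\widehat\mu(\lambda)\right].$$ -/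

import Mathlib

open MeasureTheory ProbabilityTheory Filter Topology

noncomputable section

namespace StableConv

/-! ### Random probabilities, random characteristic functions, stable convergence -/

section RandomMeasures

variable {Ω : Type*} [MeasurableSpace Ω]

/-- A random probability on `ℝ`: `ω ↦ μ ω C` is a random variable for every Borel set `C`, and
`μ ω` is a probability measure for almost every `ω`. -/
structure IsRandomProbability (P : Measure Ω) (μ : Ω → Measure ℝ) : Prop where
  measurable_apply : ∀ C : Set ℝ, MeasurableSet C → Measurable fun ω => μ ω C
  ae_isProbabilityMeasure : ∀ᵐ ω ∂P, IsProbabilityMeasure (μ ω)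

open Classical in
/-- The Fourier transform `∫ exp(i lam x) μ(dx, ω)` of a random probability, with the value `1`
at those `ω` where `μ ω` is not a probability measure. -/
def randomFourier (μ : Ω → Measure ℝ) (lam : ℝ) (ω : Ω) : ℂ :=
  if IsProbabilityMeasure (μ ω) then charFun (μ ω) lam else 1

/-- For almost every `ω`, `φ(lam, ω)` is the Fourier transform of `μ ω` at every `lam`. -/
def IsFourierOf (P : Measure Ω) (φ : ℝ → Ω → ℂ) (μ : Ω → Measure ℝ) : Prop :=
  ∀ᵐ ω ∂P, ∀ lam : ℝ, φ lam ω = randomFourier μ lam ω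

/-- Random characteristic functions: jointly measurable maps which are a.s. the Fourier transform
of some random probability. -/
def IsRandomCharFun (P : Measure Ω) (φ : ℝ → Ω → ℂ) : Prop :=
  Measurable (Function.uncurry φ) ∧
    ∃ μ : Ω → Measure ℝ, IsRandomProbability P μ ∧ IsFourierOf P φ μ

/-- Random characteristic functions that a.s. vanish nowhere. -/
def IsNonvanishingRandomCharFun (P : Measure Ω) (φ : ℝ → Ω → ℂ) : Prop :=
  IsRandomCharFun P φ ∧ ∀ᵐ ω ∂P, ∀ lam : ℝ, φ lam ω ≠ 0

/-- `Fs`-stable convergence of the real random variables `Y n` to the mixture `E μ(·)`: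
`E[Z exp(i lam Y n)] → E[Z μ̂(lam)]` for every real `lam` and every bounded random variable `Z`
that is measurable for the completion of `Fs` (that is, a.e. equal to an `Fs`-measurable one). -/
def StablyConverges (P : Measure Ω) (Fs : MeasurableSpace Ω) (Y : ℕ → Ω → ℝ)
    (μ : Ω → Measure ℝ) : Prop :=
  ∀ (lam : ℝ) (Z : Ω → ℝ), AEStronglyMeasurable[Fs] Z P → (∃ C : ℝ, ∀ᵐ ω ∂P, |Z ω| ≤ C) →
    Tendsto (fun n => ∫ ω, (Z ω : ℂ) * Complex.exp (Complex.I * lam * Y n ω) ∂P) atTop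
      (𝓝 (∫ ω, (Z ω : ℂ) * randomFourier μ lam ω ∂P))

end RandomMeasures

/-! ### Lévy-Khintchine exponents -/

/-- The pair `(c², ν)` is a Lévy-Khintchine pair for the (centered, square integrable) law `ρ`. -/
structure IsLevyKhintchinePair (ρ : Measure ℝ) (c2 : ℝ) (ν : Measure ℝ) : Prop where
  nonneg : 0 ≤ c2
  singleton_zero : ν {0} = 0
  small : ∫⁻ x, ENNReal.ofReal (min (x ^ 2) 1) ∂ν < ⊤
  large : ∫⁻ x in {x : ℝ | 1 ≤ |x|}, ENNReal.ofReal (x ^ 2) ∂ν < ⊤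
  charFun_eq : ∀ lam : ℝ, charFun ρ lam =
    Complex.exp (-(c2 * lam ^ 2 / 2 : ℝ) +
      ∫ x : ℝ, (Complex.exp (Complex.I * lam * x) - 1 - Complex.I * lam * x) ∂ν)

open Classical in
/-- The Lévy-Khintchine exponent
`-c² lam² / 2 + ∫ (exp(i lam x) - 1 - i lam x) ν(dx)` of the law `ρ`, where `(c², ν)` is its
(unique) Lévy-Khintchine pair. Centered square integrable infinitely divisible laws all have
such a pair; for the other laws, which do not matter, the value is a logarithm of the
characteristic function. -/
def levyExponent (ρ : Measure ℝ) (lam : ℝ) : ℂ :=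
  if h : ∃ p : ℝ × Measure ℝ, IsLevyKhintchinePair ρ p.1 p.2 then
    -(h.choose.1 * lam ^ 2 / 2 : ℝ) +
      ∫ x : ℝ, (Complex.exp (Complex.I * lam * x) - 1 - Complex.I * lam * x) ∂h.choose.2
  else Complex.log (charFun ρ lam)

/-! ### Processes indexed by a Hilbert space, resolutions of the identity -/

section Hilbert

variable {Ω : Type*} [MeasurableSpace Ω]
variable {H : Type*} [NormedAddCommGroup H] [InnerProductSpace ℝ H]

/-- A centered, square integrable process indexed by `H` with `E[X(f) X(g)] = (f, g)`. -/
structure IsIsometricProcess (P : Measure Ω) (X : H → Ω → ℝ) : Prop where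
  measurable : ∀ f, Measurable (X f)
  memLp : ∀ f, MemLp (X f) 2 P
  centered : ∀ f, ∫ ω, X f ω ∂P = 0
  isometry : ∀ f g, ∫ ω, X f ω * X g ω ∂P = inner ℝ f g

/-- The `σ`-field `σ{X(f) : f ∈ S}`. -/
@[reducible] def sigmaOf (X : H → Ω → ℝ) (S : Set H) : MeasurableSpace Ω :=
  ⨆ f ∈ S, MeasurableSpace.comap (X f) inferInstance

/-- `π` is a continuous resolution of the identity of `H`. -/
structure IsResolution [CompleteSpace H] (π : unitInterval → H →L[ℝ] H) : Prop where
  projection : ∀ t, IsStarProjection (π t)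
  zero : π 0 = 0
  one : π 1 = ContinuousLinearMap.id ℝ H
  mono : ∀ s t, s < t → Set.range (π s) ⊆ Set.range (π t)
  continuous : ∀ h, Continuous fun t => π t h

/-- `X` has `π`-independent increments. -/
def HasIndepIncrements (P : Measure Ω) (X : H → Ω → ℝ) (π : unitInterval → H →L[ℝ] H) : Prop :=
  ∀ (m : ℕ), 2 ≤ m → ∀ (h : Fin m → H) (t : Fin (m + 1) → unitInterval), StrictMono t →
    iIndepFun (fun i : Fin m => X ((π (t i.succ) - π (t i.castSucc)) (h i))) P

/-- The class `R_X(H)`: resolutions of the identity for which `X` has independent increments. -/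
def IsResolutionFor [CompleteSpace H] (P : Measure Ω) (X : H → Ω → ℝ)
    (π : unitInterval → H →L[ℝ] H) : Prop :=
  IsResolution π ∧ HasIndepIncrements P X π

/-- The exponent `ψ_H(h; lam)`, i.e. the Lévy-Khintchine exponent of the law of `X(h)`. -/
def psi (P : Measure Ω) (X : H → Ω → ℝ) (h : H) (lam : ℝ) : ℂ :=
  levyExponent (P.map (X h)) lam

/-- The filtration `F_t^π(X) = σ{X(π_t f) : f ∈ H}`. -/
@[reducible] def resFiltration (X : H → Ω → ℝ) (π : unitInterval → H →L[ℝ] H) (t : unitInterval) :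
    MeasurableSpace Ω :=
  sigmaOf X (Set.range (π t))

/-- `π_{≤ t} H*`: the closed linear subspace generated by `{π_s f : f ∈ H*, s ≤ t}`. -/
def projUpTo (π : unitInterval → H →L[ℝ] H) (t : unitInterval) (Hs : Submodule ℝ H) :
    Submodule ℝ H :=
  (Submodule.span ℝ {x | ∃ f ∈ Hs, ∃ s ≤ t, x = π s f}).topologicalClosure

/-! ### Adapted integrands -/

/-- The elementary elements `E_π(H, H*, X)`: linear combinations of the `H`-valued random
variables `Ψ (π_{t₂} - π_{t₁}) g`, with `t₁ < t₂`, `g ∈ H*`, and `Ψ` square integrable and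
measurable for the completion of `σ{X(f) : f ∈ π_{≤ t₁} H*}`. -/
def elementary (P : Measure Ω) (X : H → Ω → ℝ) (π : unitInterval → H →L[ℝ] H)
    (Hs : Submodule ℝ H) : Submodule ℝ (Lp H 2 P) :=
  Submodule.span ℝ {Y | ∃ (t₁ t₂ : unitInterval) (g : H) (Ψ : Ω → ℝ), t₁ < t₂ ∧ g ∈ Hs ∧
    MemLp Ψ 2 P ∧ AEStronglyMeasurable[sigmaOf X (projUpTo π t₁ Hs)] Ψ P ∧
    Y =ᵐ[P] fun ω => Ψ ω • (π t₂ - π t₁) g}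

/-- `L²_π(H, H*, X)`: the closure in `L²` of the elementary elements. -/
def adaptedL2 (P : Measure Ω) (X : H → Ω → ℝ) (π : unitInterval → H →L[ℝ] H)
    (Hs : Submodule ℝ H) : Submodule ℝ (Lp H 2 P) :=
  (elementary P X π Hs).topologicalClosure

/-! ### The Itô type integral -/

/-- The graph of the stochastic integral on elementary integrands: the linear span of the pairs
`(Φ (π_{t₂} - π_{t₁}) f, Φ X((π_{t₂} - π_{t₁}) f))`, with `t₁ < t₂`, `f ∈ H`, and `Φ` square
integrable and measurable for the completion of `F_{t₁}^π(X)`. -/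
def elementaryGraph (P : Measure Ω) (X : H → Ω → ℝ) (π : unitInterval → H →L[ℝ] H) :
    Submodule ℝ (Lp H 2 P × Lp ℝ 2 P) :=
  Submodule.span ℝ {Yv | ∃ (t₁ t₂ : unitInterval) (f : H) (Φ : Ω → ℝ), t₁ < t₂ ∧
    MemLp Φ 2 P ∧ AEStronglyMeasurable[resFiltration X π t₁] Φ P ∧
    (Yv.1 =ᵐ[P] fun ω => Φ ω • (π t₂ - π t₁) f) ∧
    Yv.2 =ᵐ[P] fun ω => Φ ω * X ((π t₂ - π t₁) f) ω}

open Classical in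
/-- The stochastic integral `J_X^π(u)`: the continuous extension of the elementary integral, i.e.
the value at `u` of the map whose graph is the closure of the elementary graph (`0` for `u`
outside the domain `L²_π(H, X)` of that map). -/
def itoIntegral (P : Measure Ω) (X : H → Ω → ℝ) (π : unitInterval → H →L[ℝ] H)
    (u : Lp H 2 P) : Lp ℝ 2 P :=
  if h : ∃ v : Lp ℝ 2 P, (u, v) ∈ (elementaryGraph P X π).topologicalClosure then h.choose
  else 0

end Hilbert

end StableConv

end

noncomputable section

namespace StableConv

/-! ### Sigma-fields generated by subfamilies of the process. -/

section Sigma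

variable {Ω H : Type*} {X : H → Ω → ℝ}

/-! The proof is the principle of conditioning. Write `chi(h)` for the characteristic function of
`X(h)` at `lam`. Independence of increments makes `chi` multiplicative over successive increments
and nowhere zero, and `exp ψ(h; lam) = chi(h)` (`chi_ne_zero`, `exp_psi`). For an elementary
integrand `y` vanishing before time `t`, with integral `v`, cut time by a grid. Given the past, the
exponential of each increment of the integral has conditional mean `chi` of the corresponding piece
of `y`, and these values multiply to `chi(y)`. So `exp(i lam v) / chi(y)` is the terminal value of a
product martingale of mean `1` given the past of `t`. Because `chi(y)` may be small, the product is
stopped just before its denominator drops below `δ` in modulus. This costs no adaptedness, as the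
denominator is predictable, and leaves a factor `ξ` bounded by `δ⁻¹` (`integral_mul_prod_expFactor`,
`hasConditioningFactor_sum`).

Since `π_{t_n} u_n → 0` in `L²`, `u_n` is `L²`-close to such an elementary `y_n`, and by the Itô
isometry `J(u_n)` is close to its integral (`exists_elementary_approx`, `norm_itoIntegral_sub_le`).
Then `exp(i lam J(u_n)) ≈ ξ_n chi(y_n) ≈ ξ_n φ ≈ ξ_n ψ_n`, where `ψ_n` is a `σ(U_n)`-measurable `L¹`
approximation of `φ`. Such `ψ_n` exist because the `U_n` increase and `φ` is measurable for their
limit; they are known at time `t_n`, so `ξ_n ψ_n` has conditional expectation exactly `ψ_n`. The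
stopping costs at most a multiple of `P(|φ| ≤ 2δ)`, which tends to `0` with `δ` because `φ` does not
vanish (`integral_norm_condExp_sub_le`). This gives `L¹` convergence of the conditional
characteristic functions. Stable convergence follows by approximating `Z` by `σ(U_n)`-measurable
variables and conditioning (`tendsto_integral_mul_exp`). -/

lemma sigmaOf_le [mΩ : MeasurableSpace Ω] (hX : ∀ f, Measurable (X f)) (S : Set H) :
    sigmaOf X S ≤ mΩ :=
  iSup₂_le fun f _ => (hX f).comap_le

lemma sigmaOf_mono {S T : Set H} (h : S ⊆ T) : sigmaOf X S ≤ sigmaOf X T :=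
  biSup_mono fun _ hf => h hf

lemma measurable_sigmaOf {S : Set H} {f : H} (hf : f ∈ S) : Measurable[sigmaOf X S] (X f) := by
  refine Measurable.of_comap_le ?_
  exact le_iSup₂ (f := fun f (_ : f ∈ S) => MeasurableSpace.comap (X f) inferInstance) f hf

/-- The form in which independence of processes can be tested on finite subfamilies. -/
lemma sigmaOf_eq_comap (S : Set H) :
    sigmaOf X S = MeasurableSpace.comap (fun ω (f : S) => X f ω) MeasurableSpace.pi := by
  simp only [MeasurableSpace.pi, MeasurableSpace.comap_iSup, MeasurableSpace.comap_comp, sigmaOf,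
    iSup_subtype]
  rfl

end Sigma

lemma pi_clm_apply_eq_sum {K : Type*} [Fintype K] [DecidableEq K] (M : (K → ℝ) →L[ℝ] ℝ)
    (x : K → ℝ) : M x = ∑ i, M (Pi.single i 1) * x i := by
  conv_lhs => rw [← Finset.univ_sum_single x, map_sum]
  refine Finset.sum_congr rfl fun i _ => ?_
  have : Pi.single i (x i) = x i • Pi.single (M := fun _ => ℝ) i (1 : ℝ) := by
    rw [← Pi.single_smul, smul_eq_mul, mul_one]
  rw [this, map_smul, smul_eq_mul, mul_comm]

/-! ### Linearity of the process, characteristic functions, independence on subspaces. -/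

section Isometry

variable {Ω : Type*} [MeasurableSpace Ω] {P : Measure Ω}
variable {H : Type*} [NormedAddCommGroup H] [InnerProductSpace ℝ H] {X : H → Ω → ℝ}

lemma norm_exp_mul_I_sub_exp_mul_I_le (a b : ℝ) :
    ‖Complex.exp (a * Complex.I) - Complex.exp (b * Complex.I)‖ ≤ |a - b| := by
  have h : Complex.exp (a * Complex.I) - Complex.exp (b * Complex.I)
      = Complex.exp (b * Complex.I) * (Complex.exp (Complex.I * ((a - b : ℝ) : ℂ)) - 1) := by
    rw [mul_sub, mul_one, ← Complex.exp_add]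
    congr 2
    push_cast
    ring
  rw [h, norm_mul, Complex.norm_exp_ofReal_mul_I, one_mul]
  exact Real.norm_exp_I_mul_ofReal_sub_one_le

/-- The isometry `f ↦ X f` from `H` into `L²`. -/
def toLp (hX : IsIsometricProcess P X) (f : H) : Lp ℝ 2 P := (hX.memLp f).toLp (X f)

lemma coeFn_toLp (hX : IsIsometricProcess P X) (f : H) : toLp hX f =ᵐ[P] X f :=
  (hX.memLp f).coeFn_toLp

lemma inner_toLp (hX : IsIsometricProcess P X) (f g : H) :
    inner ℝ (toLp hX f) (toLp hX g) = inner ℝ f g := by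
  rw [L2.inner_def, ← hX.isometry f g]
  refine integral_congr_ae ?_
  filter_upwards [coeFn_toLp hX f, coeFn_toLp hX g] with ω h1 h2
  simp [h1, h2, mul_comm]

/-- Linearity is not assumed: it follows from the covariance, since the squared `L²` norm of the
defect expands into inner products in `H` that cancel. -/
lemma toLp_add (hX : IsIsometricProcess P X) (f g : H) :
    toLp hX (f + g) = toLp hX f + toLp hX g := by
  rw [← sub_eq_zero, ← inner_self_eq_zero (𝕜 := ℝ)]
  simp only [inner_sub_left, inner_sub_right, inner_add_left, inner_add_right, inner_toLp]
  ring

lemma toLp_smul (hX : IsIsometricProcess P X) (c : ℝ) (f : H) :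
    toLp hX (c • f) = c • toLp hX f := by
  rw [← sub_eq_zero, ← inner_self_eq_zero (𝕜 := ℝ)]
  simp only [inner_sub_left, inner_sub_right, real_inner_smul_left, real_inner_smul_right,
    inner_toLp]
  ring

/-- The linear isometry `f ↦ X f` from `H` into `L²`. -/
def toLpIsometry (hX : IsIsometricProcess P X) : H →ₗᵢ[ℝ] Lp ℝ 2 P :=
  LinearMap.isometryOfInner ⟨⟨toLp hX, toLp_add hX⟩, toLp_smul hX⟩ (inner_toLp hX)

lemma coeFn_toLpIsometry (hX : IsIsometricProcess P X) (f : H) :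
    toLpIsometry hX f =ᵐ[P] X f := coeFn_toLp hX f

lemma IsIsometricProcess.map_add_ae (hX : IsIsometricProcess P X) (f g : H) :
    X (f + g) =ᵐ[P] fun ω => X f ω + X g ω := by
  have h := coeFn_toLp hX (f + g)
  rw [toLp_add] at h
  filter_upwards [h, Lp.coeFn_add (toLp hX f) (toLp hX g), coeFn_toLp hX f, coeFn_toLp hX g]
    with ω h1 h2 h3 h4
  rw [← h1, h2, Pi.add_apply, h3, h4]

lemma IsIsometricProcess.map_sum_ae (hX : IsIsometricProcess P X) {ι : Type*} (s : Finset ι)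
    (c : ι → ℝ) (f : ι → H) :
    X (∑ i ∈ s, c i • f i) =ᵐ[P] fun ω => ∑ i ∈ s, c i * X (f i) ω := by
  have h := coeFn_toLpIsometry hX (∑ i ∈ s, c i • f i)
  rw [map_sum] at h
  have h2 : ∀ᵐ ω ∂P, ∀ i ∈ s, toLpIsometry hX (c i • f i) ω = c i * X (f i) ω := by
    refine (Finset.eventually_all s).2 fun i _ => ?_
    rw [map_smul]
    filter_upwards [Lp.coeFn_smul (c i) (toLpIsometry hX (f i)), coeFn_toLpIsometry hX (f i)]
      with ω h3 h4
    rw [h3, Pi.smul_apply, h4, smul_eq_mul]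
  filter_upwards [h, h2, Lp.coeFn_finsetSum s (fun i => toLpIsometry hX (c i • f i))]
    with ω h1 h2 h3
  rw [← h1, h3, Finset.sum_apply]
  exact Finset.sum_congr rfl h2

lemma IsIsometricProcess.map_zero_ae (hX : IsIsometricProcess P X) : X 0 =ᵐ[P] 0 := by
  filter_upwards [hX.map_sum_ae (∅ : Finset ℕ) (fun _ => 0) (fun _ => 0)] with ω h
  simpa using h

/-- Cauchy-Schwarz against the constant `1`, then the isometry. -/
lemma IsIsometricProcess.integral_abs_sub_le [IsProbabilityMeasure P]
    (hX : IsIsometricProcess P X) (f g : H) : ∫ ω, |X f ω - X g ω| ∂P ≤ ‖f - g‖ := by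
  have h1 : ∫ ω, |X f ω - X g ω| ∂P
      ≤ (∫ ω, |X f ω - X g ω| ^ 2 ∂P) ^ (1 / 2 : ℝ) := by
    have hm : MemLp (fun ω => |X f ω - X g ω|) (ENNReal.ofReal 2) P := by
      rw [ENNReal.ofReal_ofNat]
      exact ((hX.memLp f).sub (hX.memLp g)).abs
    have := integral_mul_le_Lp_mul_Lq_of_nonneg (μ := P) (p := 2) (q := 2)
      (f := fun ω => |X f ω - X g ω|) (g := fun _ => (1 : ℝ)) Real.HolderConjugate.two_two
      (ae_of_all _ fun _ => abs_nonneg _) (ae_of_all _ fun _ => zero_le_one) hm (memLp_const 1)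
    simpa using this
  refine h1.trans ?_
  have h2 : ∫ ω, |X f ω - X g ω| ^ 2 ∂P = ‖f - g‖ ^ 2 := by
    have e : ∀ ω, |X f ω - X g ω| ^ 2
        = X f ω * X f ω - 2 * (X f ω * X g ω) + X g ω * X g ω := by
      intro ω; rw [sq_abs]; ring
    have i (f g : H) : Integrable (fun ω => X f ω * X g ω) P :=
      (hX.memLp f).integrable_mul (hX.memLp g)
    have i1 := i f f
    have i2 := i f g
    simp_rw [e]
    have i3 : Integrable (fun ω => X f ω * X f ω - 2 * (X f ω * X g ω)) P :=
      i1.sub (i2.const_mul 2)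
    rw [integral_add i3 (i g g), integral_sub i1 (i2.const_mul 2),
      integral_const_mul, hX.isometry, hX.isometry, hX.isometry, norm_sub_sq_real,
      real_inner_self_eq_norm_sq, real_inner_self_eq_norm_sq]
  rw [h2, ← Real.sqrt_eq_rpow, Real.sqrt_sq (norm_nonneg _)]

/-- The characteristic function of `X h`. -/
def chi (P : Measure Ω) (X : H → Ω → ℝ) (lam : ℝ) (h : H) : ℂ := charFun (P.map (X h)) lam

lemma chi_eq_integral (hX : IsIsometricProcess P X) (lam : ℝ) (h : H) :
    chi P X lam h = ∫ ω, Complex.exp ((lam * X h ω : ℝ) * Complex.I) ∂P := by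
  rw [chi, charFun_apply_real, integral_map (hX.measurable h).aemeasurable
    (by fun_prop)]
  simp

variable [IsProbabilityMeasure P]

lemma norm_chi_le_one (hX : IsIsometricProcess P X) (lam : ℝ) (h : H) :
    ‖chi P X lam h‖ ≤ 1 := by
  have := Measure.isProbabilityMeasure_map (μ := P) (hX.measurable h).aemeasurable
  exact norm_charFun_le_one _

lemma integrable_exp_mul_I {Y : Ω → ℝ} (hY : AEStronglyMeasurable Y P) :
    Integrable (fun ω => Complex.exp ((Y ω : ℝ) * Complex.I)) P := by
  refine Integrable.of_bound (C := 1) (by fun_prop) (ae_of_all _ fun ω => ?_)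
  rw [Complex.norm_exp_ofReal_mul_I]

lemma norm_chi_sub_le (hX : IsIsometricProcess P X) (lam : ℝ) (f g : H) :
    ‖chi P X lam f - chi P X lam g‖ ≤ |lam| * ‖f - g‖ := by
  have hm := fun h => (hX.measurable h).aestronglyMeasurable (μ := P)
  rw [chi_eq_integral hX, chi_eq_integral hX, ← integral_sub
    (integrable_exp_mul_I ((hm f).const_mul lam)) (integrable_exp_mul_I ((hm g).const_mul lam))]
  refine (norm_integral_le_integral_norm _).trans ?_
  refine le_trans (b := ∫ ω, |lam| * |X f ω - X g ω| ∂P) ?_ ?_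
  · refine integral_mono_of_nonneg (ae_of_all _ fun _ => norm_nonneg _) ?_ (ae_of_all _ fun ω => ?_)
    · exact ((((hX.memLp f).sub (hX.memLp g)).integrable (by norm_num)).abs).const_mul _
    · refine (norm_exp_mul_I_sub_exp_mul_I_le _ _).trans ?_
      rw [← mul_sub, abs_mul]
  · rw [integral_const_mul]
    exact mul_le_mul_of_nonneg_left (hX.integral_abs_sub_le f g) (abs_nonneg _)

lemma continuous_chi (hX : IsIsometricProcess P X) (lam : ℝ) : Continuous (chi P X lam) := by
  refine LipschitzWith.continuous (K := ⟨|lam|, abs_nonneg _⟩) (LipschitzWith.of_dist_le_mul ?_)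
  intro f g
  rw [dist_eq_norm, dist_eq_norm]
  exact norm_chi_sub_le hX lam f g

lemma chi_zero (hX : IsIsometricProcess P X) (lam : ℝ) : chi P X lam 0 = 1 := by
  rw [chi_eq_integral hX, integral_congr_ae (g := fun _ => 1)]
  · simp
  · filter_upwards [hX.map_zero_ae] with ω h
    simp [h]

lemma chi_add (hX : IsIsometricProcess P X) (lam : ℝ) {f g : H} (h : IndepFun (X f) (X g) P) :
    chi P X lam (f + g) = chi P X lam f * chi P X lam g := by
  rw [chi, Measure.map_congr (hX.map_add_ae f g),
    h.charFun_map_fun_add_eq_mul (hX.measurable f).aemeasurable (hX.measurable g).aemeasurable]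
  rfl

/-- Independence of a Hilbert space indexed process on two subspaces reduces to independence of
single variables, by linearity. -/
lemma indep_sigmaOf (hX : IsIsometricProcess P X) {S T : Submodule ℝ H}
    (h : ∀ f ∈ S, ∀ g ∈ T, IndepFun (X f) (X g) P) :
    Indep (sigmaOf X (S : Set H)) (sigmaOf X (T : Set H)) P := by
  rw [sigmaOf_eq_comap, sigmaOf_eq_comap]
  refine IndepFun.process_indepFun_process (X := fun (f : (S : Set H)) ω => X f ω)
    (Y := fun (f : (T : Set H)) ω => X f ω)
    (fun f => hX.measurable f) (fun f => hX.measurable f) fun I J => ?_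
  have mI : Measurable (fun ω (i : I) => X (i : (S : Set H)) ω) :=
    measurable_pi_lambda _ fun _ => hX.measurable _
  have mJ : Measurable (fun ω (i : J) => X (i : (T : Set H)) ω) :=
    measurable_pi_lambda _ fun _ => hX.measurable _
  rw [indepFun_iff_charFunDual_prod mI.aemeasurable mJ.aemeasurable]
  intro L
  classical
  set L1 := L.comp (.inl ℝ (I → ℝ) (J → ℝ)) with hL1
  set L2 := L.comp (.inr ℝ (I → ℝ) (J → ℝ)) with hL2
  -- Cramér-Wold: a linear functional of two finite families of values of `X` is a.e. `X f + X g`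
  -- for these `f ∈ S` and `g ∈ T`, so the joint characteristic function factors by the scalar
  -- hypothesis.
  set f : H := ∑ i : I, L1 (Pi.single i 1) • ((i : (S : Set H)) : H) with hf
  set g : H := ∑ j : J, L2 (Pi.single j 1) • ((j : (T : Set H)) : H) with hg
  have e1 : (fun ω => L1 (fun i : I => X (i : (S : Set H)) ω)) =ᵐ[P] X f := by
    filter_upwards [hX.map_sum_ae Finset.univ (fun i : I => L1 (Pi.single i 1))
      (fun i : I => ((i : (S : Set H)) : H))] with ω h1
    rw [hf, h1, pi_clm_apply_eq_sum]
  have e2 : (fun ω => L2 (fun i : J => X (i : (T : Set H)) ω)) =ᵐ[P] X g := by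
    filter_upwards [hX.map_sum_ae Finset.univ (fun i : J => L2 (Pi.single i 1))
      (fun i : J => ((i : (T : Set H)) : H))] with ω h1
    rw [hg, h1, pi_clm_apply_eq_sum]
  have hfS : f ∈ S := Submodule.sum_mem _ fun i _ => S.smul_mem _ i.1.2
  have hgT : g ∈ T := Submodule.sum_mem _ fun i _ => T.smul_mem _ i.1.2
  have i12 := h f hfS g hgT
  rw [charFunDual_apply, charFunDual_apply, charFunDual_apply,
    integral_map mI.aemeasurable (by fun_prop), integral_map mJ.aemeasurable (by fun_prop),
    integral_map (mI.prodMk mJ).aemeasurable (by fun_prop)]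
  have a1 : ∫ ω, Complex.exp (L (fun i : I => X (i : (S : Set H)) ω,
      fun i : J => X (i : (T : Set H)) ω) * Complex.I) ∂P
      = ∫ ω, Complex.exp (X f ω * Complex.I) * Complex.exp (X g ω * Complex.I) ∂P := by
    refine integral_congr_ae ?_
    filter_upwards [e1, e2] with ω h1 h2
    rw [← Complex.exp_add, ← add_mul, ← h1, ← h2]
    congr 2
    rw [hL1, hL2, ← Complex.ofReal_add]
    congr 1
    simp only [ContinuousLinearMap.comp_apply, ContinuousLinearMap.inl_apply,
      ContinuousLinearMap.inr_apply]
    rw [← map_add]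
    simp
  rw [a1, i12.integral_fun_comp_mul_comp (f := fun x : ℝ => Complex.exp (x * Complex.I))
    (g := fun x : ℝ => Complex.exp (x * Complex.I)) (hX.measurable f).aemeasurable
    (hX.measurable g).aemeasurable (by fun_prop) (by fun_prop)]
  congr 1
  · refine integral_congr_ae ?_
    filter_upwards [e1] with ω h1
    rw [← h1]
  · refine integral_congr_ae ?_
    filter_upwards [e2] with ω h1
    rw [← h1]

end Isometry

/-! ### Algebra of resolutions of the identity. -/

section Resolution

variable {H : Type*} [NormedAddCommGroup H] [InnerProductSpace ℝ H] [CompleteSpace H]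
variable {π : unitInterval → H →L[ℝ] H}

lemma IsResolution.apply_of_mem_range (hπ : IsResolution π) {t : unitInterval} {x : H}
    (hx : x ∈ Set.range (π t)) : π t x = x := by
  obtain ⟨y, rfl⟩ := hx
  exact congrArg (fun A : H →L[ℝ] H => A y) (hπ.projection t).isIdempotentElem

lemma IsResolution.range_mono (hπ : IsResolution π) {s t : unitInterval} (h : s ≤ t) :
    Set.range (π s) ⊆ Set.range (π t) := by
  rcases h.eq_or_lt with rfl | h
  · exact subset_rfl
  · exact hπ.mono s t h

lemma IsResolution.apply_apply_of_le (hπ : IsResolution π) {s t : unitInterval} (h : s ≤ t)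
    (x : H) : π t (π s x) = π s x :=
  hπ.apply_of_mem_range (hπ.range_mono h ⟨x, rfl⟩)

lemma IsResolution.inner_left (hπ : IsResolution π) (t : unitInterval) (x y : H) :
    inner ℝ (π t x) y = inner ℝ x (π t y) := by
  have h := (ContinuousLinearMap.isSelfAdjoint_iff'.1 (hπ.projection t).isSelfAdjoint)
  conv_rhs => rw [← h]
  exact (ContinuousLinearMap.adjoint_inner_right (π t) x y).symm

/-- The adjoint of `apply_apply_of_le`. -/
lemma IsResolution.apply_apply_of_ge (hπ : IsResolution π) {s t : unitInterval} (h : s ≤ t)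
    (x : H) : π s (π t x) = π s x := by
  refine ext_inner_right ℝ fun y => ?_
  rw [hπ.inner_left, hπ.inner_left, hπ.apply_apply_of_le h, hπ.inner_left]

lemma IsResolution.norm_sub_apply_le (hπ : IsResolution π) (t : unitInterval) (x : H) :
    ‖x - π t x‖ ≤ ‖x‖ := by
  have h1 : inner ℝ x (π t x) = ‖π t x‖ ^ 2 := by
    rw [← real_inner_self_eq_norm_sq, hπ.inner_left, hπ.apply_apply_of_le le_rfl]
  have h : ‖x - π t x‖ ^ 2 ≤ ‖x‖ ^ 2 := by
    rw [norm_sub_sq_real, h1]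
    nlinarith [sq_nonneg ‖π t x‖]
  exact le_of_sq_le_sq h (norm_nonneg _)

lemma IsResolution.isClosed_range (hπ : IsResolution π) (t : unitInterval) :
    IsClosed (Set.range (π t)) := by
  have : Set.range (π t) = {x | π t x = x} := by
    ext x
    exact ⟨fun hx => hπ.apply_of_mem_range hx, fun hx => ⟨x, hx⟩⟩
  rw [this]
  exact isClosed_eq (π t).continuous continuous_id

lemma IsResolution.projUpTo_subset (hπ : IsResolution π) (t : unitInterval)
    (Hs : Submodule ℝ H) : (projUpTo π t Hs : Set H) ⊆ Set.range (π t) := by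
  have h : projUpTo π t Hs ≤ LinearMap.range (π t).toLinearMap := by
    refine Submodule.topologicalClosure_minimal _ (Submodule.span_le.2 ?_) ?_
    · rintro x ⟨f, -, s, hs, rfl⟩
      exact hπ.range_mono hs ⟨f, rfl⟩
    · exact hπ.isClosed_range t
  exact h

lemma resFiltration_mono {Ω : Type*} (X : H → Ω → ℝ) (hπ : IsResolution π) {s t : unitInterval}
    (h : s ≤ t) : resFiltration X π s ≤ resFiltration X π t :=
  sigmaOf_mono (hπ.range_mono h)

end Resolution

/-! ### Independence up to completion, and products of independent variables. -/

section IndepFun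

variable {Ω : Type*} [MeasurableSpace Ω] {P : Measure Ω}

/-- Integrands are measurable only for completed sigma-fields; passing to a measurable version does
not affect independence. -/
lemma indepFun_of_indep {m₁ m₂ : MeasurableSpace Ω} (h : Indep m₁ m₂ P)
    {E F : Type*} [TopologicalSpace E] [MeasurableSpace E] [BorelSpace E]
    [TopologicalSpace.PseudoMetrizableSpace E] [MeasurableSpace F]
    {Y : Ω → E} {V : Ω → F} (hY : AEStronglyMeasurable[m₁] Y P) (hV : Measurable[m₂] V) :
    IndepFun Y V P := by
  have h1 : IndepFun (hY.mk Y) V P :=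
    indep_of_indep_of_le_left (indep_of_indep_of_le_right h hV.comap_le)
      hY.stronglyMeasurable_mk.measurable.comap_le
  exact h1.congr hY.ae_eq_mk.symm Filter.EventuallyEq.rfl

lemma IndepFun.memLp_two_mul {Y V : Ω → ℝ} (h : IndepFun Y V P) (hY : MemLp Y 2 P)
    (hV : MemLp V 2 P) : MemLp (fun ω => Y ω * V ω) 2 P := by
  refine (memLp_two_iff_integrable_sq (hY.1.mul hV.1)).2 ?_
  have := IndepFun.integrable_mul (h.comp (φ := fun x : ℝ => x ^ 2) (ψ := fun x : ℝ => x ^ 2)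
    (by fun_prop) (by fun_prop)) hY.integrable_sq hV.integrable_sq
  refine this.congr (ae_of_all _ fun ω => ?_)
  simp [mul_pow]

end IndepFun

/-! ### Past and future of a resolution; nonvanishing characteristic functions. -/

section IndepIncrements

variable {Ω : Type*} [MeasurableSpace Ω] {P : Measure Ω} [IsProbabilityMeasure P]
variable {H : Type*} [NormedAddCommGroup H] [InnerProductSpace ℝ H] [CompleteSpace H]
variable {X : H → Ω → ℝ} {π : unitInterval → H →L[ℝ] H}

/-- The `σ`-field generated by the increments of `X` after time `c`. -/
@[reducible] def futureSigma (X : H → Ω → ℝ) (π : unitInterval → H →L[ℝ] H) (c : unitInterval) :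
    MeasurableSpace Ω :=
  sigmaOf X (LinearMap.range (1 - π c).toLinearMap : Submodule ℝ H)

lemma indepFun_of_ae_eq_zero_left {f g : Ω → ℝ} (hf : f =ᵐ[P] 0) : IndepFun f g P :=
  (IndepFun.congr (indepFun_const_left (0 : ℝ) g) hf.symm Filter.EventuallyEq.rfl)

/-- By linearity one past and one future variable suffice, and these are the two increments over the
partition `0 < c < 1`. -/
lemma indep_past_future (hX : IsIsometricProcess P X) (hπ : IsResolutionFor P X π)
    (c : unitInterval) : Indep (resFiltration X π c) (futureSigma X π c) P := by
  have key : Indep (sigmaOf X (LinearMap.range (π c).toLinearMap : Submodule ℝ H))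
      (futureSigma X π c) P := by
    refine indep_sigmaOf hX ?_
    rintro _ ⟨f, rfl⟩ _ ⟨g, rfl⟩
    -- The partition must be strictly increasing, so the endpoints are separate; there one of the
    -- two variables is a.e. zero.
    by_cases h0 : c = 0
    · refine indepFun_of_ae_eq_zero_left ?_
      subst h0
      simpa [hπ.1.zero] using hX.map_zero_ae
    by_cases h1 : c = 1
    · refine (indepFun_of_ae_eq_zero_left ?_).symm
      subst h1
      simpa [hπ.1.one] using hX.map_zero_ae
    have hc0 : 0 < c := unitInterval.pos_iff_ne_zero.2 h0
    have hc1 : c < 1 := unitInterval.lt_one_iff_ne_one.2 h1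
    have hmono : StrictMono (![0, c, 1] : Fin 3 → unitInterval) := by
      refine Fin.strictMono_iff_lt_succ.2 fun i => ?_
      fin_cases i
      · simpa using hc0
      · simpa using hc1
    have := (hπ.2 2 le_rfl ![f, g] ![0, c, 1] hmono).indepFun (i := 0) (j := 1) (by decide)
    simpa [hπ.1.zero, hπ.1.one] using this
  exact key

/-- Fubini for the product law of the pair. -/
lemma IndepFun.integral_fun_comp_prod {E F : Type*} [MeasurableSpace E] [MeasurableSpace F]
    {Y : Ω → E} {V : Ω → F} (h : IndepFun Y V P) (hY : AEMeasurable Y P) (hV : AEMeasurable V P)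
    {f : E → F → ℂ} (hf : StronglyMeasurable (Function.uncurry f))
    (hint : Integrable (fun ω => f (Y ω) (V ω)) P) :
    ∫ ω, f (Y ω) (V ω) ∂P = ∫ ω, ∫ ω', f (Y ω) (V ω') ∂P ∂P := by
  have hmap := (indepFun_iff_map_prod_eq_prod_map_map hY hV).1 h
  have hp1 := Measure.isProbabilityMeasure_map (μ := P) hY
  have hp2 := Measure.isProbabilityMeasure_map (μ := P) hV
  have e1 : ∫ ω, f (Y ω) (V ω) ∂P
      = ∫ z, Function.uncurry f z ∂(P.map fun ω => (Y ω, V ω)) := by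
    rw [integral_map (hY.prodMk hV) hf.aestronglyMeasurable]
    rfl
  have hint' : Integrable (Function.uncurry f) ((P.map Y).prod (P.map V)) := by
    rw [← hmap, integrable_map_measure hf.aestronglyMeasurable (hY.prodMk hV)]
    exact hint
  rw [e1, hmap, integral_prod _ hint', integral_map hY]
  · refine integral_congr_ae (ae_of_all _ fun ω => ?_)
    simp only [Function.uncurry_apply_pair]
    rw [integral_map hV]
    exact (hf.comp_measurable (measurable_prodMk_left)).aestronglyMeasurable
  · exact hf.integral_prod_right.aestronglyMeasurable

lemma chi_add_inc (hX : IsIsometricProcess P X) (hπ : IsResolutionFor P X π) (lam : ℝ)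
    {c : unitInterval} {f g : H} (hf : π c f = f) (hg : π c g = 0) :
    chi P X lam (f + g) = chi P X lam f * chi P X lam g := by
  refine chi_add hX lam ?_
  refine indepFun_of_indep (indep_past_future hX hπ c) ?_ ?_
  · have hm : Measurable[resFiltration X π c] (X f) := measurable_sigmaOf ⟨f, hf⟩
    exact hm.stronglyMeasurable.aestronglyMeasurable
  · exact measurable_sigmaOf ⟨g, by simp [hg]⟩

/-- The law of `X h` has a nonvanishing characteristic function, since `X h` is a sum of
arbitrarily small independent increments. -/
lemma chi_ne_zero (hX : IsIsometricProcess P X) (hπ : IsResolutionFor P X π) (lam : ℝ) (h : H) :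
    chi P X lam h ≠ 0 := by
  intro hzero
  have hcont : Continuous fun t => chi P X lam (π t h) :=
    (continuous_chi hX lam).comp (hπ.1.continuous h)
  have hclosed : IsClosed {t : unitInterval | chi P X lam (π t h) = 0} :=
    isClosed_eq hcont continuous_const
  -- Take the first time `t` at which `chi (π t h)` vanishes; it is positive as `chi 0 = 1`. For `s
  -- < t` multiplicativity moves the zero to the increment from `s` to `t`, whose characteristic
  -- function nevertheless tends to `1` as `s` increases to `t`.
  obtain ⟨t, ht, hmin⟩ := hclosed.isCompact.exists_isLeast ⟨1, by simpa [hπ.1.one] using hzero⟩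
  have ht0 : 0 < t := by
    refine unitInterval.pos_iff_ne_zero.2 fun h0 => ?_
    rw [Set.mem_ofPred_eq, h0, hπ.1.zero] at ht
    simp [chi_zero hX] at ht
  have hlt : ∀ s < t, chi P X lam (π t h - π s h) = 0 := by
    intro s hs
    have hmul := chi_add_inc hX hπ lam (c := s) (f := π s h) (g := π t h - π s h)
      (hπ.1.apply_apply_of_le le_rfl h)
      (by rw [map_sub, hπ.1.apply_apply_of_ge hs.le, hπ.1.apply_apply_of_ge le_rfl, sub_self])
    rw [add_sub_cancel, show chi P X lam (π t h) = 0 from ht] at hmul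
    refine (mul_eq_zero.1 hmul.symm).resolve_left fun h0 => ?_
    exact absurd (hmin h0) (not_le.2 hs)
  have hlim : Tendsto (fun s => chi P X lam (π t h - π s h)) (𝓝[<] t) (𝓝 1) := by
    have : Continuous fun s => chi P X lam (π t h - π s h) :=
      (continuous_chi hX lam).comp (continuous_const.sub (hπ.1.continuous h))
    have h2 := this.tendsto t
    rw [sub_self, chi_zero hX] at h2
    exact h2.mono_left nhdsWithin_le_nhds
  have hne : (𝓝[<] t).NeBot := by
    refine nhdsLT_neBot_of_exists_lt ⟨0, ht0⟩
  have hlim0 : Tendsto (fun s => chi P X lam (π t h - π s h)) (𝓝[<] t) (𝓝 0) :=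
    tendsto_const_nhds.congr' (eventually_nhdsWithin_of_forall fun s hs => (hlt s hs).symm)
  exact one_ne_zero (tendsto_nhds_unique hlim hlim0)

/-- Existence of a Lévy-Khintchine pair is never needed: in the other branch of `levyExponent` the
exponent is a logarithm of a nonzero number. -/
lemma exp_psi (hX : IsIsometricProcess P X) (hπ : IsResolutionFor P X π) (lam : ℝ) (h : H) :
    Complex.exp (psi P X h lam) = chi P X lam h := by
  rw [psi, levyExponent]
  split_ifs with hex
  · exact (hex.choose_spec.charFun_eq lam).symm
  · exact Complex.exp_log (chi_ne_zero hX hπ lam h)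

end IndepIncrements

lemma measurable_futureSigma {Ω H : Type*} [NormedAddCommGroup H] [InnerProductSpace ℝ H]
    {X : H → Ω → ℝ} {π : unitInterval → H →L[ℝ] H} {c : unitInterval} {x : H} (hx : π c x = 0) :
    Measurable[futureSigma X π c] (X x) :=
  measurable_sigmaOf ⟨x, by simp [hx]⟩

/-! ### The Itô isometry and the domain of the integral. -/

section Ito

variable {Ω : Type*} [MeasurableSpace Ω] {P : Measure Ω} [IsProbabilityMeasure P]
variable {H : Type*} [NormedAddCommGroup H] [InnerProductSpace ℝ H] [CompleteSpace H]
variable {X : H → Ω → ℝ} {π : unitInterval → H →L[ℝ] H}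

lemma IsResolution.apply_inc (hπ : IsResolution π) {c a b : unitInterval} (ha : c ≤ a)
    (hb : c ≤ b) (f : H) : π c ((π b - π a) f) = 0 := by
  simp [hπ.apply_apply_of_ge ha, hπ.apply_apply_of_ge hb]

lemma memLp_mul_inc (hX : IsIsometricProcess P X) (hπ : IsResolutionFor P X π)
    {a : unitInterval} {Φ : Ω → ℝ} (hΦ : MemLp Φ 2 P)
    (hΦm : AEStronglyMeasurable[resFiltration X π a] Φ P) {x : H} (hx : π a x = 0) :
    MemLp (fun ω => Φ ω * X x ω) 2 P :=
  IndepFun.memLp_two_mul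
    (indepFun_of_indep (indep_past_future hX hπ a) hΦm (measurable_futureSigma hx)) hΦ (hX.memLp x)

/-- Split `y` at the later time `c`. The part before `c`, together with both coefficients, is
independent of the centered `X z` and contributes nothing. The part after `c` is independent of the
coefficients, and its covariance with `X z` is that of `y`. -/
lemma integral_mul_inc_mul_inc_of_le (hX : IsIsometricProcess P X) (hπ : IsResolutionFor P X π)
    {a c : unitInterval} (hac : a ≤ c) {Φ Φ' : Ω → ℝ} (hΦ : MemLp Φ 2 P) (hΦ' : MemLp Φ' 2 P)
    (hΦm : AEStronglyMeasurable[resFiltration X π a] Φ P)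
    (hΦm' : AEStronglyMeasurable[resFiltration X π c] Φ' P) {y z : H} (hy : π a y = 0)
    (hz : π c z = 0) :
    ∫ ω, (Φ ω * X y ω) * (Φ' ω * X z ω) ∂P = (∫ ω, Φ ω * Φ' ω ∂P) * inner ℝ y z := by
  set y₁ := π c y with hy₁
  set y₂ := y - π c y with hy₂
  have hsplit : X y =ᵐ[P] fun ω => X y₁ ω + X y₂ ω := by
    have := hX.map_add_ae y₁ y₂
    rwa [hy₁, hy₂, add_sub_cancel] at this
  have hy₁a : π a y₁ = 0 := by rw [hy₁, hπ.1.apply_apply_of_ge hac, hy]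
  have hy₂c : π c y₂ = 0 := by
    rw [hy₂, map_sub, hπ.1.apply_apply_of_le le_rfl, sub_self]
  have hpast : Measurable[resFiltration X π c] (X y₁) := measurable_sigmaOf ⟨y, rfl⟩
  have hΦc : AEStronglyMeasurable[resFiltration X π c] Φ P :=
    hΦm.mono (resFiltration_mono X hπ.1 hac)
  -- A product of three square integrable variables need not be integrable; here `Φ` and `X y₁` are
  -- independent because `y₁` lies after `a`, so their product is already in `L²`.
  have hQ : Integrable (fun ω => (Φ ω * X y₁ ω) * Φ' ω) P :=
    (memLp_mul_inc hX hπ hΦ hΦm hy₁a).integrable_mul hΦ'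
  have hQm : AEStronglyMeasurable[resFiltration X π c] (fun ω => (Φ ω * X y₁ ω) * Φ' ω) P :=
    (hΦc.mul hpast.stronglyMeasurable.aestronglyMeasurable).mul hΦm'
  have hΦΦ : Integrable (fun ω => Φ ω * Φ' ω) P := hΦ.integrable_mul hΦ'
  have hXX : Integrable (fun ω => X y₂ ω * X z ω) P := (hX.memLp y₂).integrable_mul (hX.memLp z)
  have hXz : Integrable (X z) P := (hX.memLp z).integrable (by norm_num)
  have i1 : IndepFun (fun ω => (Φ ω * X y₁ ω) * Φ' ω) (X z) P :=
    indepFun_of_indep (indep_past_future hX hπ c) hQm (measurable_futureSigma hz)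
  have hmXX : Measurable[futureSigma X π c] (fun ω => X y₂ ω * X z ω) :=
    (measurable_futureSigma hy₂c).mul (measurable_futureSigma hz)
  have i2 : IndepFun (fun ω => Φ ω * Φ' ω) (fun ω => X y₂ ω * X z ω) P :=
    indepFun_of_indep (indep_past_future hX hπ c) (hΦc.mul hΦm') hmXX
  have e : (fun ω => (Φ ω * X y ω) * (Φ' ω * X z ω)) =ᵐ[P] fun ω =>
      ((Φ ω * X y₁ ω) * Φ' ω) * X z ω + (Φ ω * Φ' ω) * (X y₂ ω * X z ω) := by
    filter_upwards [hsplit] with ω h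
    rw [h]
    ring
  have hinner : inner ℝ y z = inner ℝ y₂ z := by
    rw [hy₂, inner_sub_left, hπ.1.inner_left, hz, inner_zero_right, sub_zero]
  have j1 : Integrable (fun ω => ((Φ ω * X y₁ ω) * Φ' ω) * X z ω) P := i1.integrable_mul hQ hXz
  have j2 : Integrable (fun ω => (Φ ω * Φ' ω) * (X y₂ ω * X z ω)) P := i2.integrable_mul hΦΦ hXX
  rw [integral_congr_ae e, integral_add j1 j2,
    i1.integral_fun_mul_eq_mul_integral hQ.1 hXz.1, i2.integral_fun_mul_eq_mul_integral hΦΦ.1 hXX.1,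
    hX.centered, hX.isometry, hinner]
  simp

lemma integral_mul_inc_mul_inc (hX : IsIsometricProcess P X) (hπ : IsResolutionFor P X π)
    {a c : unitInterval} {Φ Φ' : Ω → ℝ} (hΦ : MemLp Φ 2 P) (hΦ' : MemLp Φ' 2 P)
    (hΦm : AEStronglyMeasurable[resFiltration X π a] Φ P)
    (hΦm' : AEStronglyMeasurable[resFiltration X π c] Φ' P) {y z : H} (hy : π a y = 0)
    (hz : π c z = 0) :
    ∫ ω, (Φ ω * X y ω) * (Φ' ω * X z ω) ∂P = (∫ ω, Φ ω * Φ' ω ∂P) * inner ℝ y z := by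
  rcases le_total a c with h | h
  · exact integral_mul_inc_mul_inc_of_le hX hπ h hΦ hΦ' hΦm hΦm' hy hz
  · have := integral_mul_inc_mul_inc_of_le hX hπ h hΦ' hΦ hΦm' hΦm hz hy
    rw [real_inner_comm]
    simpa only [mul_comm] using this

/-- The polarized identity is bilinear, so it passes from generators to their span; equality of
norms alone would not. -/
lemma inner_elementaryGraph (hX : IsIsometricProcess P X) (hπ : IsResolutionFor P X π)
    {p q : Lp H 2 P × Lp ℝ 2 P} (hp : p ∈ elementaryGraph P X π) (hq : q ∈ elementaryGraph P X π) :
    inner ℝ p.1 q.1 = inner ℝ p.2 q.2 := by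
  unfold elementaryGraph at hp hq
  induction hp, hq using Submodule.span_induction₂ with
  | mem_mem p q hp hq =>
    obtain ⟨a, b, f, Φ, hab, hΦ, hΦm, h1, h2⟩ := hp
    obtain ⟨c, d, g, Φ', hcd, hΦ', hΦm', h1', h2'⟩ := hq
    have key := integral_mul_inc_mul_inc hX hπ hΦ hΦ' hΦm hΦm'
      (hπ.1.apply_inc le_rfl hab.le f) (hπ.1.apply_inc le_rfl hcd.le g)
    rw [L2.inner_def, L2.inner_def]
    trans (∫ ω, Φ ω * Φ' ω ∂P) * inner ℝ ((π b - π a) f) ((π d - π c) g)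
    · rw [← integral_mul_const]
      refine integral_congr_ae ?_
      filter_upwards [h1, h1'] with ω e1 e2
      rw [e1, e2, real_inner_smul_left, real_inner_smul_right, mul_assoc]
    · rw [← key]
      refine integral_congr_ae ?_
      filter_upwards [h2, h2'] with ω e1 e2
      rw [e1, e2, real_inner_eq_re_inner, mul_comm]
      simp
  | zero_left => simp
  | zero_right => simp
  | add_left p q r _ _ _ h1 h2 => simp [inner_add_left, h1, h2]
  | add_right p q r _ _ _ h1 h2 => simp [inner_add_right, h1, h2]
  | smul_left c p q _ _ h => simp [real_inner_smul_left, h]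
  | smul_right c p q _ _ h => simp [real_inner_smul_right, h]

lemma norm_snd_elementaryGraph (hX : IsIsometricProcess P X) (hπ : IsResolutionFor P X π)
    {p : Lp H 2 P × Lp ℝ 2 P} (hp : p ∈ elementaryGraph P X π) : ‖p.2‖ = ‖p.1‖ := by
  have h := inner_elementaryGraph hX hπ hp hp
  rw [real_inner_self_eq_norm_sq, real_inner_self_eq_norm_sq] at h
  exact (sq_eq_sq₀ (norm_nonneg _) (norm_nonneg _)).1 h.symm

lemma dist_snd_elementaryGraph (hX : IsIsometricProcess P X) (hπ : IsResolutionFor P X π)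
    {y y' : Lp H 2 P} {v v' : Lp ℝ 2 P} (h : (y, v) ∈ elementaryGraph P X π)
    (h' : (y', v') ∈ elementaryGraph P X π) : dist v v' = dist y y' := by
  have e := norm_snd_elementaryGraph hX hπ ((elementaryGraph P X π).sub_mem h h')
  rw [Prod.mk_sub_mk] at e
  rw [dist_eq_norm v, dist_eq_norm y]
  exact e

/-- The Itô isometry. -/
lemma norm_snd_closure_elementaryGraph (hX : IsIsometricProcess P X)
    (hπ : IsResolutionFor P X π) {p : Lp H 2 P × Lp ℝ 2 P}
    (hp : p ∈ (elementaryGraph P X π).topologicalClosure) : ‖p.2‖ = ‖p.1‖ := by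
  have hc : IsClosed {p : Lp H 2 P × Lp ℝ 2 P | ‖p.2‖ = ‖p.1‖} :=
    isClosed_eq (by fun_prop) (by fun_prop)
  exact closure_minimal (fun p hp => norm_snd_elementaryGraph hX hπ hp) hc hp

/-- The `L²` class of an elementary integrand and of its integral, as an element of the graph. -/
lemma exists_mem_elementaryGraph (hX : IsIsometricProcess P X) (hπ : IsResolutionFor P X π)
    {a b : unitInterval} (hab : a ≤ b) (f : H) {Φ : Ω → ℝ} (hΦ : MemLp Φ 2 P)
    (hΦm : AEStronglyMeasurable[resFiltration X π a] Φ P) :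
    ∃ p ∈ elementaryGraph P X π, (p.1 =ᵐ[P] fun ω => Φ ω • (π b - π a) f) ∧
      p.2 =ᵐ[P] fun ω => Φ ω * X ((π b - π a) f) ω := by
  -- Degenerate intervals are allowed because cutting an interval at a time `t` may collapse it.
  rcases hab.eq_or_lt with rfl | hab
  · refine ⟨0, Submodule.zero_mem _, ?_, ?_⟩
    · filter_upwards [] with ω
      simp
    · filter_upwards [hX.map_zero_ae] with ω h'
      simp [h']
  · have m1 : MemLp (fun ω => Φ ω • (π b - π a) f) 2 P := by
      refine (hΦ.norm.mul_const ‖(π b - π a) f‖).mono (hΦ.1.smul_const _) (ae_of_all _ fun ω => ?_)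
      rw [norm_smul, norm_mul, norm_norm, norm_norm]
    have m2 := memLp_mul_inc hX hπ hΦ hΦm (hπ.1.apply_inc le_rfl hab.le f)
    exact ⟨(m1.toLp _, m2.toLp _), Submodule.subset_span
      ⟨a, b, f, Φ, hab, hΦ, hΦm, m1.coeFn_toLp, m2.coeFn_toLp⟩, m1.coeFn_toLp, m2.coeFn_toLp⟩

/-- Elementary integrands belong to the domain of the elementary graph. -/
lemma exists_graph_of_mem_elementary (hX : IsIsometricProcess P X) (hπ : IsResolutionFor P X π)
    {Hs : Submodule ℝ H} {y : Lp H 2 P} (hy : y ∈ elementary P X π Hs) :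
    ∃ v, (y, v) ∈ elementaryGraph P X π := by
  have h : elementary P X π Hs ≤ (elementaryGraph P X π).map (LinearMap.fst ℝ _ _) := by
    refine Submodule.span_le.2 ?_
    rintro Y ⟨a, b, g, Ψ, hab, -, hΨ, hΨm, hY⟩
    obtain ⟨p, hp, h1, -⟩ := exists_mem_elementaryGraph hX hπ hab.le g hΨ
      (hΨm.mono (sigmaOf_mono (hπ.1.projUpTo_subset a Hs)))
    exact ⟨p, hp, Lp.ext (h1.trans hY.symm)⟩
  obtain ⟨⟨y', v⟩, hp, rfl⟩ := h hy
  exact ⟨v, hp⟩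

/-- The stochastic integral is defined on the whole of `L²_π(H, H*, X)`. -/
lemma itoIntegral_mem (hX : IsIsometricProcess P X) (hπ : IsResolutionFor P X π)
    {Hs : Submodule ℝ H} {u : Lp H 2 P} (hu : u ∈ adaptedL2 P X π Hs) :
    (u, itoIntegral P X π u) ∈ (elementaryGraph P X π).topologicalClosure := by
  have hex : ∃ v : Lp ℝ 2 P, (u, v) ∈ (elementaryGraph P X π).topologicalClosure := by
    have hu' : u ∈ closure (elementary P X π Hs : Set (Lp H 2 P)) := hu
    obtain ⟨y, hy, hlim⟩ := mem_closure_iff_seq_limit.1 hu'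
    have hgraph := fun n => exists_graph_of_mem_elementary hX hπ (hy n)
    obtain ⟨v, hv⟩ := Classical.axiomOfChoice hgraph
    -- The graph is isometric, so the integrals of an approximating sequence are Cauchy along with
    -- the integrands.
    have hdist : ∀ m n, dist (v m) (v n) = dist (y m) (y n) := fun m n =>
      dist_snd_elementaryGraph hX hπ (hv m) (hv n)
    have hcauchy : CauchySeq v := by
      have := hlim.cauchySeq
      rw [Metric.cauchySeq_iff] at this ⊢
      simpa only [hdist] using this
    obtain ⟨w, hw⟩ := cauchySeq_tendsto_of_complete hcauchy
    have hmem : (u, w) ∈ closure (elementaryGraph P X π : Set (Lp H 2 P × Lp ℝ 2 P)) :=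
      mem_closure_iff_seq_limit.2 ⟨fun n => (y n, v n), hv, hlim.prodMk_nhds hw⟩
    exact ⟨w, hmem⟩
  rw [itoIntegral, dif_pos hex]
  exact hex.choose_spec

lemma norm_itoIntegral_sub_le (hX : IsIsometricProcess P X) (hπ : IsResolutionFor P X π)
    {Hs : Submodule ℝ H} {u : Lp H 2 P} (hu : u ∈ adaptedL2 P X π Hs)
    {y : Lp H 2 P} {v : Lp ℝ 2 P} (hp : (y, v) ∈ elementaryGraph P X π) :
    ‖itoIntegral P X π u - v‖ = ‖u - y‖ := by
  have e := norm_snd_closure_elementaryGraph hX hπ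
    ((elementaryGraph P X π).topologicalClosure.sub_mem (itoIntegral_mem hX hπ hu)
      (Submodule.le_topologicalClosure _ hp))
  rw [Prod.mk_sub_mk] at e
  exact e

end Ito

/-! ### A common grid for finitely many intervals. -/

lemma exists_grid {α : Type*} [LinearOrder α] {n : ℕ} (t : α) (a b : Fin n → α)
    (hab : ∀ i, a i ≤ b i) (ht : ∀ i, t ≤ a i) :
    ∃ (s : ℕ → α) (K : ℕ) (p q : Fin n → ℕ), Monotone s ∧ t ≤ s 0 ∧
      ∀ i, p i ≤ q i ∧ q i ≤ K ∧ s (p i) = a i ∧ s (q i) = b i := by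
  set T : Finset α := insert t (Finset.univ.image a ∪ Finset.univ.image b) with hT
  have hpos : 0 < T.card := Finset.card_pos.2 ⟨t, Finset.mem_insert_self _ _⟩
  set e := T.orderEmbOfFin rfl with he
  have hidx : ∀ x ∈ T, ∃ j, e j = x := fun x hx => by
    have : x ∈ Set.range e := by rw [he, Finset.range_orderEmbOfFin]; exact hx
    exact this
  have ha : ∀ i, a i ∈ T := fun i => by simp [hT]
  have hb : ∀ i, b i ∈ T := fun i => by simp [hT]
  choose p hp using fun i => hidx _ (ha i)
  choose q hq using fun i => hidx _ (hb i)
  have hs : ∀ j : Fin T.card, e ⟨min j (T.card - 1), by omega⟩ = e j := fun j => by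
    congr 1
    ext
    simp only
    omega
  -- The sorted endpoints, together with `t`, are continued as a constant sequence beyond the last
  -- one, so that the grid is indexed by `ℕ` and the surplus cells are trivial.
  refine ⟨fun k => e ⟨min k (T.card - 1), by omega⟩, T.card, fun i => p i, fun i => q i, ?_, ?_, ?_⟩
  · intro k l hkl
    refine e.monotone ?_
    rw [Fin.mk_le_mk]
    exact min_le_min_right _ hkl
  · have : e ⟨min 0 (T.card - 1), by omega⟩ ∈ T := Finset.orderEmbOfFin_mem _ _ _
    have hle : ∀ x ∈ T, t ≤ x := by
      intro x hx
      rw [hT, Finset.mem_insert, Finset.mem_union, Finset.mem_image, Finset.mem_image] at hx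
      rcases hx with rfl | ⟨i, -, rfl⟩ | ⟨i, -, rfl⟩
      · exact le_rfl
      · exact ht i
      · exact (ht i).trans (hab i)
    exact hle _ this
  · intro i
    refine ⟨?_, (q i).2.le, (hs _).trans (hp i), (hs _).trans (hq i)⟩
    rw [Fin.val_fin_le, ← e.le_iff_le, hp, hq]
    exact hab i

/-! ### Freezing coefficients known at a given time. -/

section Freezing

variable {Ω : Type*} [MeasurableSpace Ω] {P : Measure Ω} [IsProbabilityMeasure P]
variable {H : Type*} [NormedAddCommGroup H] [InnerProductSpace ℝ H] [CompleteSpace H]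
variable {X : H → Ω → ℝ} {π : unitInterval → H →L[ℝ] H}

/-- Conditional characteristic function of a sum of increments after time `c` with coefficients
known at time `c`. -/
lemma integral_mul_exp_sum_inc (hX : IsIsometricProcess P X) (hπ : IsResolutionFor P X π)
    (lam : ℝ) {c : unitInterval} {ι : Type*} [Fintype ι] {Ψ : ι → Ω → ℝ} {f : ι → H}
    (hΨ : ∀ i, Measurable[resFiltration X π c] (Ψ i)) (hf : ∀ i, π c (f i) = 0) {G : Ω → ℂ}
    (hG : Measurable[resFiltration X π c] G) {C : ℝ} (hC : ∀ᵐ ω ∂P, ‖G ω‖ ≤ C) :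
    ∫ ω, G ω * Complex.exp ((lam * ∑ i, Ψ i ω * X (f i) ω : ℝ) * Complex.I) ∂P
      = ∫ ω, G ω * chi P X lam (∑ i, Ψ i ω • f i) ∂P := by
  have hle : resFiltration X π c ≤ ‹MeasurableSpace Ω› := sigmaOf_le hX.measurable _
  -- The weight `G` is packed with the coefficients into one past variable, independent of the
  -- vector of future increments.
  set Y : Ω → ℂ × (ι → ℝ) := fun ω => (G ω, fun i => Ψ i ω) with hY
  set V : Ω → ι → ℝ := fun ω i => X (f i) ω with hV
  have hYm : Measurable[resFiltration X π c] Y :=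
    hG.prodMk (@measurable_pi_lambda _ _ _ (resFiltration X π c) _ _ hΨ)
  have hVm : Measurable[futureSigma X π c] V :=
    @measurable_pi_lambda _ _ _ (futureSigma X π c) _ _ fun i => measurable_futureSigma (hf i)
  have hVm' : Measurable V := measurable_pi_lambda _ fun i => hX.measurable _
  have hind : IndepFun Y V P := indepFun_of_indep (indep_past_future hX hπ c)
    hYm.stronglyMeasurable.aestronglyMeasurable hVm
  have key := IndepFun.integral_fun_comp_prod hind (hYm.mono hle le_rfl).aemeasurable
    hVm'.aemeasurable
    (f := fun y v => y.1 * Complex.exp ((lam * ∑ i, y.2 i * v i : ℝ) * Complex.I)) ?_ ?_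
  · rw [key]
    refine integral_congr_ae (ae_of_all _ fun ω => ?_)
    simp only [hY, hV]
    rw [integral_const_mul, chi_eq_integral hX]
    congr 1
    refine integral_congr_ae ?_
    filter_upwards [hX.map_sum_ae Finset.univ (fun i => Ψ i ω) f] with ω' h
    rw [h]
  · refine Measurable.stronglyMeasurable ?_
    unfold Function.uncurry
    fun_prop
  · have hYm' := hYm.mono hle le_rfl
    refine Integrable.of_bound (C := C) ?_ ?_
    · refine Measurable.aestronglyMeasurable ?_
      fun_prop
    · filter_upwards [hC] with ω h
      rw [norm_mul, Complex.norm_exp_ofReal_mul_I, mul_one]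
      exact h

end Freezing

/-! ### Increments over a grid and their adaptedness. -/

section Grid

variable {Ω : Type*} {H : Type*} [NormedAddCommGroup H] [InnerProductSpace ℝ H]
variable (X : H → Ω → ℝ) (π : unitInterval → H →L[ℝ] H)
variable {ι : Type*} [Fintype ι] (s : ℕ → unitInterval) (Ψ : ℕ → ι → Ω → ℝ) (f : ι → H)

/-- The contribution of the `k`-th interval of a grid to an elementary integrand. -/
def gridTerm (k : ℕ) (ω : Ω) : H := ∑ i, Ψ k i ω • (π (s (k + 1)) - π (s k)) (f i)

/-- The contribution of the `k`-th interval of a grid to an elementary integral. -/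
def gridInc (k : ℕ) (ω : Ω) : ℝ := ∑ i, Ψ k i ω * X ((π (s (k + 1)) - π (s k)) (f i)) ω

variable {X π s Ψ f}

lemma stronglyMeasurable_gridTerm (hΨ : ∀ k i, Measurable[resFiltration X π (s k)] (Ψ k i))
    (k : ℕ) : StronglyMeasurable[resFiltration X π (s k)] (gridTerm π s Ψ f k) := by
  unfold gridTerm
  exact Finset.stronglyMeasurable_fun_sum _ fun i _ => (hΨ k i).stronglyMeasurable.smul_const _

lemma measurable_gridInc [CompleteSpace H] (hπ : IsResolution π) (hs : Monotone s)
    (hΨ : ∀ k i, Measurable[resFiltration X π (s k)] (Ψ k i)) (k : ℕ) :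
    Measurable[resFiltration X π (s (k + 1))] (gridInc X π s Ψ f k) := by
  unfold gridInc
  refine Finset.measurable_fun_sum _ fun i _ => ?_
  refine ((hΨ k i).mono (resFiltration_mono X hπ (hs k.le_succ)) le_rfl).mul ?_
  refine measurable_sigmaOf ⟨(π (s (k + 1)) - π (s k)) (f i), ?_⟩
  simp [hπ.apply_apply_of_le le_rfl, hπ.apply_apply_of_le (hs k.le_succ)]

lemma prod_norm_chi_succ_le [MeasurableSpace Ω] {P : Measure Ω} [IsProbabilityMeasure P]
    (hX : IsIsometricProcess P X) (lam : ℝ) (K : ℕ) (ω : Ω) :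
    ∏ k ∈ Finset.range (K + 1), ‖chi P X lam (gridTerm π s Ψ f k ω)‖
      ≤ ∏ k ∈ Finset.range K, ‖chi P X lam (gridTerm π s Ψ f k ω)‖ := by
  rw [Finset.prod_range_succ]
  exact mul_le_of_le_one_right (Finset.prod_nonneg fun _ _ => norm_nonneg _)
    (norm_chi_le_one hX lam _)

lemma measurable_chi_gridTerm [MeasurableSpace Ω] {P : Measure Ω} [IsProbabilityMeasure P]
    (hX : IsIsometricProcess P X)
    (hΨ : ∀ k i, Measurable[resFiltration X π (s k)] (Ψ k i))
    (lam : ℝ) (k : ℕ) :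
    Measurable[resFiltration X π (s k)] fun ω => chi P X lam (gridTerm π s Ψ f k ω) :=
  ((continuous_chi hX lam).comp_stronglyMeasurable (stronglyMeasurable_gridTerm hΨ k)).measurable

end Grid

/-! ### The stopped exponential martingale on a grid. -/

section Conditioning

variable {Ω : Type*} [MeasurableSpace Ω] {P : Measure Ω} [IsProbabilityMeasure P]
variable {H : Type*} [NormedAddCommGroup H] [InnerProductSpace ℝ H] [CompleteSpace H]
variable {X : H → Ω → ℝ} {π : unitInterval → H →L[ℝ] H}
variable {ι : Type*} [Fintype ι] {s : ℕ → unitInterval} {Ψ : ℕ → ι → Ω → ℝ} {f : ι → H}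

/-- At fixed `ω` the coefficients are constants, so the terms are deterministic vectors in
successive increments of the resolution. -/
lemma chi_sum_gridTerm (hX : IsIsometricProcess P X) (hπ : IsResolutionFor P X π) (lam : ℝ)
    (hs : Monotone s) (K : ℕ) (ω : Ω) :
    chi P X lam (∑ k ∈ Finset.range K, gridTerm π s Ψ f k ω)
      = ∏ k ∈ Finset.range K, chi P X lam (gridTerm π s Ψ f k ω) := by
  induction K with
  | zero => simp [chi_zero hX]
  | succ K ih =>
    rw [Finset.sum_range_succ, Finset.prod_range_succ, ← ih]
    refine chi_add_inc hX hπ lam (c := s K) ?_ ?_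
    · rw [map_sum]
      refine Finset.sum_congr rfl fun k hk => ?_
      have h1 : s k ≤ s K := hs (Finset.mem_range.1 hk).le
      have h2 : s (k + 1) ≤ s K := hs (Finset.mem_range.1 hk)
      simp [gridTerm, hπ.1.apply_apply_of_le h1, hπ.1.apply_apply_of_le h2]
    · rw [gridTerm, map_sum]
      refine Finset.sum_eq_zero fun i _ => ?_
      rw [map_smul, hπ.1.apply_inc le_rfl (hs K.le_succ), smul_zero]

variable (P X π s Ψ f) in
/-- The factors of the exponential martingale attached to an elementary integral, stopped before
the product of the moduli of the conditional characteristic functions falls below `δ`. -/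
def expFactor (lam δ : ℝ) (k : ℕ) (ω : Ω) : ℂ :=
  if δ ≤ ∏ j ∈ Finset.range (k + 1), ‖chi P X lam (gridTerm π s Ψ f j ω)‖ then
    Complex.exp ((lam * gridInc X π s Ψ f k ω : ℝ) * Complex.I) *
      (chi P X lam (gridTerm π s Ψ f k ω))⁻¹
  else 1

/-- The partial products of moduli decrease, so the bound at `K` forces it at every earlier index:
no factor has been stopped, and all denominators cancel. -/
lemma prod_expFactor (hX : IsIsometricProcess P X) (hπ : IsResolutionFor P X π) (lam : ℝ)
    {δ : ℝ} (K : ℕ) (ω : Ω)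
    (h : δ ≤ ∏ k ∈ Finset.range K, ‖chi P X lam (gridTerm π s Ψ f k ω)‖) :
    Complex.exp ((lam * ∑ k ∈ Finset.range K, gridInc X π s Ψ f k ω : ℝ) * Complex.I)
      = (∏ k ∈ Finset.range K, expFactor P X π s Ψ f lam δ k ω) *
        ∏ k ∈ Finset.range K, chi P X lam (gridTerm π s Ψ f k ω) := by
  induction K with
  | zero => simp
  | succ K ih =>
    have hne := chi_ne_zero hX hπ lam (gridTerm π s Ψ f K ω)
    have hK := ih (h.trans (prod_norm_chi_succ_le hX lam K ω))
    rw [Finset.prod_range_succ, Finset.prod_range_succ, Finset.sum_range_succ, mul_add,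
      Complex.ofReal_add, add_mul, Complex.exp_add, hK, expFactor, if_pos h]
    field_simp

/-- While unstopped, the product has modulus the inverse of a number at least `δ`; afterwards it is
multiplied by `1` only. -/
lemma norm_prod_expFactor_le (hX : IsIsometricProcess P X) (hπ : IsResolutionFor P X π) (lam : ℝ)
    {δ : ℝ} (hδ : 0 < δ) (hδ1 : δ ≤ 1) (K : ℕ) (ω : Ω) :
    ‖∏ k ∈ Finset.range K, expFactor P X π s Ψ f lam δ k ω‖ ≤ δ⁻¹ := by
  induction K with
  | zero => simpa using (one_le_inv₀ hδ).2 hδ1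
  | succ K ih =>
    by_cases h : δ ≤ ∏ k ∈ Finset.range (K + 1), ‖chi P X lam (gridTerm π s Ψ f k ω)‖
    · have e := congrArg norm (prod_expFactor (ι := ι) hX hπ lam (K + 1) ω h)
      rw [Complex.norm_exp_ofReal_mul_I, norm_mul, norm_prod (f := fun k =>
        chi P X lam (gridTerm π s Ψ f k ω))] at e
      rw [eq_inv_of_mul_eq_one_left e.symm]
      exact inv_anti₀ hδ h
    · rw [Finset.prod_range_succ, expFactor, if_neg h, mul_one]
      exact ih

/-- Predictability: the coefficients of the `k`-th cell are known at its left endpoint, so whether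
to stop is decided before the `k`-th increment is seen. -/
lemma measurableSet_threshold (hX : IsIsometricProcess P X) (hπ : IsResolutionFor P X π)
    (hs : Monotone s) (hΨ : ∀ k i, Measurable[resFiltration X π (s k)] (Ψ k i)) (lam δ : ℝ) (k : ℕ) :
    MeasurableSet[resFiltration X π (s k)]
      {ω | δ ≤ ∏ j ∈ Finset.range (k + 1), ‖chi P X lam (gridTerm π s Ψ f j ω)‖} := by
  have h : Measurable[resFiltration X π (s k)] fun ω =>
      ∏ j ∈ Finset.range (k + 1), ‖chi P X lam (gridTerm π s Ψ f j ω)‖ := by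
    refine Finset.measurable_fun_prod _ fun j hj => ?_
    exact measurable_norm.comp ((measurable_chi_gridTerm hX hΨ lam j).mono
      (resFiltration_mono X hπ.1 (hs (Nat.lt_succ_iff.1 (Finset.mem_range.1 hj)))) le_rfl)
  exact h measurableSet_Ici

lemma measurable_expFactor (hX : IsIsometricProcess P X) (hπ : IsResolutionFor P X π)
    (hs : Monotone s) (hΨ : ∀ k i, Measurable[resFiltration X π (s k)] (Ψ k i)) (lam δ : ℝ) (k : ℕ) :
    Measurable[resFiltration X π (s (k + 1))] (expFactor P X π s Ψ f lam δ k) := by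
  have hle := resFiltration_mono X hπ.1 (hs k.le_succ)
  unfold expFactor
  refine Measurable.ite (m := resFiltration X π (s (k + 1)))
    (hle _ (measurableSet_threshold hX hπ hs hΨ lam δ k)) ?_ measurable_const
  refine Measurable.mul ?_ ((measurable_chi_gridTerm hX hΨ lam k).mono hle le_rfl).inv
  exact Complex.measurable_exp.comp ((Complex.measurable_ofReal.comp
    ((measurable_gridInc hπ.1 hs hΨ k).const_mul lam)).mul_const _)

/-- The martingale property, by peeling off the last factor: on the unstopped event the conditional
mean of the exponential cancels the denominator, and elsewhere the factor is `1`. -/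
lemma integral_mul_prod_expFactor (hX : IsIsometricProcess P X) (hπ : IsResolutionFor P X π)
    (hs : Monotone s) (hΨ : ∀ k i, Measurable[resFiltration X π (s k)] (Ψ k i)) (lam : ℝ) {δ : ℝ} (hδ : 0 < δ)
    (hδ1 : δ ≤ 1) (K : ℕ) {Z : Ω → ℂ} (hZ : Measurable[resFiltration X π (s 0)] Z) {C : ℝ}
    (hC : ∀ᵐ ω ∂P, ‖Z ω‖ ≤ C) :
    ∫ ω, Z ω * ∏ k ∈ Finset.range K, expFactor P X π s Ψ f lam δ k ω ∂P = ∫ ω, Z ω ∂P := by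
  induction K with
  | zero => simp
  | succ K ih =>
    rw [← ih]
    have hle : resFiltration X π (s K) ≤ ‹MeasurableSpace Ω› := sigmaOf_le hX.measurable _
    set G : Ω → ℂ := fun ω => Z ω * ∏ k ∈ Finset.range K, expFactor P X π s Ψ f lam δ k ω with hG
    have hGm : Measurable[resFiltration X π (s K)] G := by
      refine (hZ.mono (resFiltration_mono X hπ.1 (hs K.zero_le)) le_rfl).mul ?_
      refine Finset.measurable_fun_prod _ fun k hk => ?_
      exact (measurable_expFactor hX hπ hs hΨ lam δ k).mono
        (resFiltration_mono X hπ.1 (hs (Finset.mem_range.1 hk))) le_rfl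
    have hGC : ∀ᵐ ω ∂P, ‖G ω‖ ≤ C * δ⁻¹ := by
      filter_upwards [hC] with ω h
      rw [hG, norm_mul]
      exact mul_le_mul h (norm_prod_expFactor_le hX hπ lam hδ hδ1 K ω) (norm_nonneg _)
        ((norm_nonneg _).trans h)
    set B := {ω | δ ≤ ∏ j ∈ Finset.range (K + 1), ‖chi P X lam (gridTerm π s Ψ f j ω)‖} with hB
    have hBm : MeasurableSet[resFiltration X π (s K)] B := measurableSet_threshold hX hπ hs hΨ lam δ K
    set w : Ω → ℂ := fun ω => chi P X lam (gridTerm π s Ψ f K ω) with hw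
    have hwm : Measurable[resFiltration X π (s K)] w := measurable_chi_gridTerm hX hΨ lam K
    -- Division by `w` takes place only on `B`, where `‖w‖ ≥ δ`; this keeps `G₁` bounded, as the
    -- freezing lemma requires.
    set G₁ : Ω → ℂ := B.indicator fun ω => G ω * (w ω)⁻¹ with hG₁
    have hG₁m : Measurable[resFiltration X π (s K)] G₁ := (hGm.mul hwm.inv).indicator hBm
    have hwB : ∀ ω ∈ B, δ ≤ ‖w ω‖ := by
      intro ω hω
      refine le_trans hω ?_
      rw [Finset.prod_range_succ]
      exact mul_le_of_le_one_left (norm_nonneg _) (Finset.prod_le_one (fun _ _ => norm_nonneg _)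
        fun _ _ => norm_chi_le_one hX lam _)
    have hG₁C : ∀ᵐ ω ∂P, ‖G₁ ω‖ ≤ C * δ⁻¹ * δ⁻¹ := by
      filter_upwards [hGC] with ω h
      by_cases hω : ω ∈ B
      · rw [hG₁, Set.indicator_of_mem hω, norm_mul, norm_inv]
        exact mul_le_mul h (inv_anti₀ hδ (hwB ω hω)) (by positivity) ((norm_nonneg _).trans h)
      · rw [hG₁, Set.indicator_of_notMem hω, norm_zero]
        exact mul_nonneg ((norm_nonneg _).trans h) (by positivity)
    have hfreeze := integral_mul_exp_sum_inc hX hπ lam (c := s K)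
      (f := fun i => (π (s (K + 1)) - π (s K)) (f i)) (hΨ K)
      (fun i => hπ.1.apply_inc le_rfl (hs K.le_succ) (f i)) hG₁m hG₁C
    have hsplit : ∀ ω, Z ω * ∏ k ∈ Finset.range (K + 1), expFactor P X π s Ψ f lam δ k ω
        = G₁ ω * Complex.exp ((lam * gridInc X π s Ψ f K ω : ℝ) * Complex.I)
          + Bᶜ.indicator G ω := by
      intro ω
      rw [Finset.prod_range_succ, ← mul_assoc, expFactor]
      by_cases hω : ω ∈ B
      · rw [if_pos (show δ ≤ _ from hω), hG₁, Set.indicator_of_mem hω,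
          Set.indicator_of_notMem (by simpa using hω)]
        simp only [hG, hw]
        ring
      · rw [if_neg (show ¬ δ ≤ _ from hω), hG₁, Set.indicator_of_notMem hω,
          Set.indicator_of_mem (by simpa using hω)]
        simp only [hG]
        ring
    have hmerge : ∀ ω, G ω = G₁ ω * chi P X lam (gridTerm π s Ψ f K ω) + Bᶜ.indicator G ω := by
      intro ω
      by_cases hω : ω ∈ B
      · rw [hG₁, Set.indicator_of_mem hω, Set.indicator_of_notMem (by simpa using hω), add_zero,
          mul_assoc, inv_mul_cancel₀ (chi_ne_zero hX hπ lam _), mul_one]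
      · rw [hG₁, Set.indicator_of_notMem hω, Set.indicator_of_mem (by simpa using hω), zero_mul,
          zero_add]
    have hGm' := hGm.mono hle le_rfl
    have hwm' := hwm.mono hle le_rfl
    have hG₁m' := hG₁m.mono hle le_rfl
    have hincm : Measurable (gridInc X π s Ψ f K) :=
      (measurable_gridInc hπ.1 hs hΨ K).mono (sigmaOf_le hX.measurable _) le_rfl
    have hGi : Integrable G P := Integrable.of_bound hGm'.aestronglyMeasurable _ hGC
    have hind : Integrable (Bᶜ.indicator G) P := hGi.indicator (hle _ hBm).compl
    have i1 : Integrable (fun ω =>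
        G₁ ω * Complex.exp ((lam * gridInc X π s Ψ f K ω : ℝ) * Complex.I)) P := by
      refine Integrable.of_bound (C := C * δ⁻¹ * δ⁻¹) ?_ ?_
      · refine Measurable.aestronglyMeasurable ?_
        fun_prop
      · filter_upwards [hG₁C] with ω h
        rw [norm_mul, Complex.norm_exp_ofReal_mul_I, mul_one]
        exact h
    have i2 : Integrable (fun ω => G₁ ω * chi P X lam (gridTerm π s Ψ f K ω)) P := by
      refine Integrable.of_bound (C := C * δ⁻¹ * δ⁻¹) (hG₁m'.mul hwm').aestronglyMeasurable ?_
      filter_upwards [hG₁C] with ω h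
      rw [norm_mul]
      exact (mul_le_of_le_one_right (norm_nonneg _) (norm_chi_le_one hX lam _)).trans h
    simp_rw [hsplit]
    rw [integral_add i1 hind, integral_congr_ae (ae_of_all P hmerge), integral_add i2 hind]
    congr 1

end Conditioning

/-- The principle of conditioning for elementary integrands that vanish before time `t`: on the
event where the conditional characteristic function has modulus at least `δ`, the exponential of
the integral is the product of that function and a bounded variable `ξ` whose conditional
expectation given the past of `t` is `1`. -/
def HasConditioningFactor {Ω H : Type*} [MeasurableSpace Ω] [NormedAddCommGroup H]
    [InnerProductSpace ℝ H] (P : Measure Ω) (X : H → Ω → ℝ) (π : unitInterval → H →L[ℝ] H)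
    (t : unitInterval) (y : Ω → H) (v : Ω → ℝ) : Prop :=
  ∀ lam δ : ℝ, 0 < δ → δ ≤ 1 → ∃ ξ : Ω → ℂ, Measurable ξ ∧ (∀ ω, ‖ξ ω‖ ≤ δ⁻¹) ∧
    (∀ (Z : Ω → ℂ) (C : ℝ), Measurable[resFiltration X π t] Z → (∀ᵐ ω ∂P, ‖Z ω‖ ≤ C) →
      ∫ ω, Z ω * ξ ω ∂P = ∫ ω, Z ω ∂P) ∧
    ∀ᵐ ω ∂P, δ ≤ ‖chi P X lam (y ω)‖ →
      Complex.exp ((lam * v ω : ℝ) * Complex.I) = ξ ω * chi P X lam (y ω)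

lemma HasConditioningFactor.congr {Ω H : Type*} [MeasurableSpace Ω] {P : Measure Ω}
    [NormedAddCommGroup H] [InnerProductSpace ℝ H] {X : H → Ω → ℝ} {π : unitInterval → H →L[ℝ] H}
    {t : unitInterval} {y y' : Ω → H} {v v' : Ω → ℝ}
    (h : HasConditioningFactor P X π t y v) (hy : y' =ᵐ[P] y) (hv : v' =ᵐ[P] v) :
    HasConditioningFactor P X π t y' v' := by
  intro lam δ hδ hδ1
  obtain ⟨ξ, h1, h2, h3, h4⟩ := h lam δ hδ hδ1
  refine ⟨ξ, h1, h2, h3, ?_⟩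
  filter_upwards [h4, hy, hv] with ω h4 h5 h6
  rwa [h5, h6]

/-! ### Elementary integrands that start at time `t`. -/

section Approximation

variable {Ω : Type*} [MeasurableSpace Ω] {P : Measure Ω} [IsProbabilityMeasure P]
variable {H : Type*} [NormedAddCommGroup H] [InnerProductSpace ℝ H] [CompleteSpace H]
variable {X : H → Ω → ℝ} {π : unitInterval → H →L[ℝ] H}

/-- After refinement to a common grid, the factor is the stopped product of the preceding part. -/
lemma hasConditioningFactor_sum (hX : IsIsometricProcess P X) (hπ : IsResolutionFor P X π)
    {t : unitInterval} {n : ℕ} {a b : Fin n → unitInterval} (hab : ∀ i, a i ≤ b i)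
    (ht : ∀ i, t ≤ a i) (g : Fin n → H) {Ψ : Fin n → Ω → ℝ}
    (hΨ : ∀ i, AEStronglyMeasurable[resFiltration X π (a i)] (Ψ i) P) :
    HasConditioningFactor P X π t (fun ω => ∑ i, Ψ i ω • (π (b i) - π (a i)) (g i))
      (fun ω => ∑ i, Ψ i ω * X ((π (b i) - π (a i)) (g i)) ω) := by
  intro lam δ hδ hδ1
  obtain ⟨s, K, p, q, hs, hts, hgrid⟩ := exists_grid t a b hab ht
  -- The `i`-th coefficient is repeated on each cell inside its interval, in a version measurable
  -- for the uncompleted sigma-field at `a i`, hence at every such cell.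
  set Θ : ℕ → Fin n → Ω → ℝ := fun k i ω =>
    if p i ≤ k ∧ k < q i then (hΨ i).mk (Ψ i) ω else 0 with hΘ
  have hΘm : ∀ k i, Measurable[resFiltration X π (s k)] (Θ k i) := by
    intro k i
    by_cases h : p i ≤ k ∧ k < q i
    · simp only [hΘ, if_pos h]
      refine (hΨ i).stronglyMeasurable_mk.measurable.mono (resFiltration_mono X hπ.1 ?_) le_rfl
      rw [← (hgrid i).2.2.1]
      exact hs h.1
    · simp only [hΘ, if_neg h]
      exact measurable_const
  have hfilter : ∀ i, (Finset.range K).filter (fun k => p i ≤ k ∧ k < q i)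
      = Finset.Ico (p i) (q i) := by
    intro i
    ext k
    have := (hgrid i).2.1
    simp only [Finset.mem_filter, Finset.mem_range, Finset.mem_Ico]
    omega
  have htel : ∀ i x, ∑ k ∈ Finset.Ico (p i) (q i), (π (s (k + 1)) - π (s k)) x
      = (π (b i) - π (a i)) x := by
    intro i x
    have := Finset.sum_Ico_sub (fun k => π (s k) x) (hgrid i).1
    simp only [sub_apply]
    rw [this, (hgrid i).2.2.1, (hgrid i).2.2.2]
  have hmk : ∀ᵐ ω ∂P, ∀ i, (hΨ i).mk (Ψ i) ω = Ψ i ω :=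
    ae_all_iff.2 fun i => (hΨ i).ae_eq_mk.symm
  have hy : ∀ᵐ ω ∂P, ∑ k ∈ Finset.range K, gridTerm π s Θ g k ω
      = ∑ i, Ψ i ω • (π (b i) - π (a i)) (g i) := by
    filter_upwards [hmk] with ω h
    simp only [gridTerm]
    rw [Finset.sum_comm]
    refine Finset.sum_congr rfl fun i _ => ?_
    simp only [hΘ, h, ite_smul, zero_smul]
    rw [← Finset.sum_filter, hfilter, ← Finset.smul_sum, htel]
  have hXtel : ∀ᵐ ω ∂P, ∀ i, X ((π (b i) - π (a i)) (g i)) ω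
      = ∑ k ∈ Finset.Ico (p i) (q i), X ((π (s (k + 1)) - π (s k)) (g i)) ω := by
    refine ae_all_iff.2 fun i => ?_
    filter_upwards [hX.map_sum_ae (Finset.Ico (p i) (q i)) (fun _ => 1)
      (fun k => (π (s (k + 1)) - π (s k)) (g i))] with ω h
    rw [← htel]
    simpa only [one_smul, one_mul] using h
  have hv : ∀ᵐ ω ∂P, ∑ k ∈ Finset.range K, gridInc X π s Θ g k ω
      = ∑ i, Ψ i ω * X ((π (b i) - π (a i)) (g i)) ω := by
    filter_upwards [hmk, hXtel] with ω h h'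
    simp only [gridInc]
    rw [Finset.sum_comm]
    refine Finset.sum_congr rfl fun i _ => ?_
    simp only [hΘ, h, ite_mul, zero_mul]
    rw [← Finset.sum_filter, hfilter, ← Finset.mul_sum, h']
  refine ⟨fun ω => ∏ k ∈ Finset.range K, expFactor P X π s Θ g lam δ k ω, ?_,
    norm_prod_expFactor_le hX hπ lam hδ hδ1 K, ?_, ?_⟩
  · exact Finset.measurable_fun_prod _ fun k _ =>
      (measurable_expFactor hX hπ hs hΘm lam δ k).mono (sigmaOf_le hX.measurable _) le_rfl
  · intro Z C hZ hC
    exact integral_mul_prod_expFactor hX hπ hs hΘm lam hδ hδ1 K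
      (hZ.mono (resFiltration_mono X hπ.1 hts) le_rfl) hC
  · filter_upwards [hy, hv] with ω h1 h2 hle
    rw [← h1, chi_sum_gridTerm hX hπ lam hs] at hle ⊢
    rw [norm_prod] at hle
    rw [← h2]
    exact prod_expFactor hX hπ lam K ω hle

/-- An adapted integrand is close to elementary integrands that vanish before time `t`, up to its
component before time `t`. -/
lemma exists_elementary_approx (hX : IsIsometricProcess P X) (hπ : IsResolutionFor P X π)
    {Hs : Submodule ℝ H} {u : Lp H 2 P} (hu : u ∈ adaptedL2 P X π Hs) (t : unitInterval)
    {ε : ℝ} (hε : 0 < ε) :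
    ∃ (y : Lp H 2 P) (v : Lp ℝ 2 P), (y, v) ∈ elementaryGraph P X π ∧
      HasConditioningFactor P X π t y v ∧ ‖u - y‖ ≤ ‖(π t).compLp u‖ + ε := by
  have hu' : u ∈ closure (elementary P X π Hs : Set (Lp H 2 P)) := hu
  obtain ⟨z, hz, hdist⟩ := Metric.mem_closure_iff.1 hu' ε hε
  obtain ⟨n, c, G, hsum⟩ := Submodule.mem_span_set'.1 hz
  have hG := fun i => (G i).2
  simp only [Set.mem_ofPred_eq] at hG
  choose α β g Ψ hαβ hg hΨ hΨm hGΨ using hG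
  -- Pushing both endpoints up to at least `t` amounts to applying `1 - π t` to the increment. Left
  -- endpoints only move later, so the coefficients stay adapted.
  set a : Fin n → unitInterval := fun i => max (α i) t with ha
  set b : Fin n → unitInterval := fun i => max (β i) t with hb
  have hab : ∀ i, a i ≤ b i := fun i => max_le_max_right _ (hαβ i).le
  set Φ : Fin n → Ω → ℝ := fun i ω => c i * Ψ i ω with hΦ
  have hΦL : ∀ i, MemLp (Φ i) 2 P := fun i => (hΨ i).const_mul (c i)
  have hΦm : ∀ i, AEStronglyMeasurable[resFiltration X π (a i)] (Φ i) P := fun i =>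
    ((hΨm i).mono ((sigmaOf_mono (hπ.1.projUpTo_subset (α i) Hs)).trans
      (resFiltration_mono X hπ.1 (le_max_left _ _)))).const_mul (c i)
  have hp := fun i => exists_mem_elementaryGraph hX hπ (hab i) (g i) (hΦL i) (hΦm i)
  obtain ⟨p, hp⟩ := Classical.axiomOfChoice hp
  have hsum1 : ((∑ i, p i).1 : Lp H 2 P) =ᵐ[P] fun ω => ∑ i, Φ i ω • (π (b i) - π (a i)) (g i) := by
    rw [Prod.fst_sum]
    filter_upwards [Lp.coeFn_finsetSum Finset.univ (fun i => (p i).1),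
      ae_all_iff.2 fun i => (hp i).2.1] with ω h1 h2
    rw [h1, Finset.sum_apply]
    exact Finset.sum_congr rfl fun i _ => h2 i
  have hsum2 : ((∑ i, p i).2 : Lp ℝ 2 P) =ᵐ[P]
      fun ω => ∑ i, Φ i ω * X ((π (b i) - π (a i)) (g i)) ω := by
    rw [Prod.snd_sum]
    filter_upwards [Lp.coeFn_finsetSum Finset.univ (fun i => (p i).2),
      ae_all_iff.2 fun i => (hp i).2.2] with ω h1 h2
    rw [h1, Finset.sum_apply]
    exact Finset.sum_congr rfl fun i _ => h2 i
  refine ⟨(∑ i, p i).1, (∑ i, p i).2, (elementaryGraph P X π).sum_mem fun i _ => (hp i).1,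
    (hasConditioningFactor_sum hX hπ hab (fun i => le_max_right _ _) g hΦm).congr hsum1 hsum2, ?_⟩
  have hinc : ∀ i, (π (b i) - π (a i)) (g i)
      = (π (β i) - π (α i)) (g i) - π t ((π (β i) - π (α i)) (g i)) := by
    intro i
    have e : ∀ r : unitInterval, π (max r t) (g i) = π r (g i) + π t (g i) - π t (π r (g i)) := by
      intro r
      rcases le_total r t with h | h
      · rw [max_eq_right h, hπ.1.apply_apply_of_le h]
        abel
      · rw [max_eq_left h, hπ.1.apply_apply_of_ge h]
        abel
    simp only [sub_apply, ha, hb, e, map_sub]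
    abel
  have hz' : z =ᵐ[P] fun ω => ∑ i, Φ i ω • (π (β i) - π (α i)) (g i) := by
    rw [← hsum]
    have h0 : ∀ᵐ ω ∂P, ∀ i, (c i • (G i : Lp H 2 P) : Lp H 2 P) ω
        = Φ i ω • (π (β i) - π (α i)) (g i) := by
      refine ae_all_iff.2 fun i => ?_
      filter_upwards [Lp.coeFn_smul (c i) (G i : Lp H 2 P), hGΨ i] with ω h1 h2
      rw [h1, Pi.smul_apply, h2, smul_smul]
    filter_upwards [Lp.coeFn_finsetSum Finset.univ (fun i => c i • (G i : Lp H 2 P)), h0]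
      with ω h1 h2
    rw [h1, Finset.sum_apply]
    exact Finset.sum_congr rfl fun i _ => h2 i
  have hyz : ((∑ i, p i).1 : Lp H 2 P) =ᵐ[P] fun ω => z ω - π t (z ω) := by
    filter_upwards [hsum1, hz'] with ω h1 h2
    rw [h1, h2, map_sum, ← Finset.sum_sub_distrib]
    refine Finset.sum_congr rfl fun i _ => ?_
    rw [hinc, map_smul, smul_sub]
  set y := (∑ i, p i).1
  -- The left side is the norm of `(1 - π t)(u - z)`, and `1 - π t` is a contraction.
  have hbound : ‖u - y - (π t).compLp u‖ ≤ ‖u - z‖ := by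
    refine Lp.norm_le_norm_of_ae_le ?_
    filter_upwards [Lp.coeFn_sub (u - y) ((π t).compLp u), Lp.coeFn_sub u y,
      Lp.coeFn_sub u z, (π t).coeFn_compLp u, hyz] with ω h1 h2 h3 h4 h5
    rw [h1, Pi.sub_apply, h2, Pi.sub_apply, h3, Pi.sub_apply, h4, h5]
    have := hπ.1.norm_sub_apply_le t (u ω - z ω)
    rw [map_sub] at this
    convert this using 2
    abel
  rw [dist_eq_norm] at hdist
  calc ‖u - y‖ = ‖(π t).compLp u + (u - y - (π t).compLp u)‖ := by rw [add_sub_cancel]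
    _ ≤ ‖(π t).compLp u‖ + ‖u - y - (π t).compLp u‖ := norm_add_le _ _
    _ ≤ ‖(π t).compLp u‖ + ε := by linarith

end Approximation

/-! ### Convergence in measure and in `L¹`; approximation along a filtration. -/

lemma norm_sq_eq_integral {Ω E : Type*} [MeasurableSpace Ω] {P : Measure Ω}
    [NormedAddCommGroup E] [InnerProductSpace ℝ E]
    (f : Lp E 2 P) : ‖f‖ ^ 2 = ∫ ω, ‖f ω‖ ^ 2 ∂P := by
  rw [← real_inner_self_eq_norm_sq, L2.inner_def]
  simp only [real_inner_self_eq_norm_sq]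

lemma tendstoInMeasure_of_tendsto_integral_norm_sub {Ω E : Type*}
    [MeasurableSpace Ω] {P : Measure Ω} [NormedAddCommGroup E]
    {f : ℕ → Ω → E} {g : Ω → E} (hf : ∀ n, Integrable (f n) P) (hg : Integrable g P)
    (h : Tendsto (fun n => ∫ ω, ‖f n ω - g ω‖ ∂P) atTop (𝓝 0)) :
    TendstoInMeasure P f atTop g := by
  refine tendstoInMeasure_of_tendsto_eLpNorm (p := 1) one_ne_zero (fun n => (hf n).1) hg.1 ?_
  have h2 := ENNReal.tendsto_ofReal h
  rw [ENNReal.ofReal_zero] at h2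
  refine h2.congr fun n => ?_
  rw [eLpNorm_one_eq_lintegral_enorm]
  exact ofReal_integral_norm_eq_lintegral_enorm ((hf n).sub hg)

section Limits

variable {Ω : Type*} [mΩ : MeasurableSpace Ω] {P : Measure Ω} [IsProbabilityMeasure P]

lemma integral_norm_le_norm {E : Type*} [NormedAddCommGroup E] (f : Lp E 2 P) :
    ∫ ω, ‖f ω‖ ∂P ≤ ‖f‖ := by
  have hf : Integrable f P := (Lp.memLp f).integrable (by norm_num)
  rw [Lp.norm_def, integral_norm_eq_lintegral_enorm hf.1, ← eLpNorm_one_eq_lintegral_enorm]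
  exact ENNReal.toReal_mono (Lp.eLpNorm_ne_top f)
    (eLpNorm_le_eLpNorm_of_exponent_le (by norm_num) hf.1)

lemma integral_norm_sub_le_norm_sub {E : Type*} [NormedAddCommGroup E] (f g : Lp E 2 P) :
    ∫ ω, ‖f ω - g ω‖ ∂P ≤ ‖f - g‖ := by
  refine le_trans (le_of_eq (integral_congr_ae ?_)) (integral_norm_le_norm (f - g))
  filter_upwards [Lp.coeFn_sub f g] with ω h
  rw [h, Pi.sub_apply]

/-- Bounded convergence in measure. -/
lemma tendsto_integral_norm_sub_of_tendstoInMeasure {E : Type*} [NormedAddCommGroup E]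
    {f : ℕ → Ω → E} {g : Ω → E} (hf : ∀ n, AEStronglyMeasurable (f n) P)
    (hg : AEStronglyMeasurable g P) {C : ℝ} (hC : ∀ n, ∀ᵐ ω ∂P, ‖f n ω - g ω‖ ≤ C)
    (h : TendstoInMeasure P f atTop g) :
    Tendsto (fun n => ∫ ω, ‖f n ω - g ω‖ ∂P) atTop (𝓝 0) := by
  have hmeas := tendstoInMeasure_iff_measureReal_norm.1 h
  have hbound : ∀ ε > 0, ∀ n, ∫ ω, ‖f n ω - g ω‖ ∂P
      ≤ ε + C * P.real {ω | ε ≤ ‖f n ω - g ω‖} := by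
    intro ε hε n
    have hm : AEStronglyMeasurable (fun ω => ‖f n ω - g ω‖) P := ((hf n).sub hg).norm
    have hS : NullMeasurableSet {ω | ε ≤ ‖f n ω - g ω‖} P :=
      nullMeasurableSet_le aemeasurable_const hm.aemeasurable
    have hi : Integrable ({ω | ε ≤ ‖f n ω - g ω‖}.indicator fun _ => C) P :=
      (integrable_const C).indicator₀ hS
    calc ∫ ω, ‖f n ω - g ω‖ ∂P
        ≤ ∫ ω, (ε + {ω | ε ≤ ‖f n ω - g ω‖}.indicator (fun _ => C) ω) ∂P := by
          refine integral_mono_of_nonneg (ae_of_all _ fun _ => norm_nonneg _)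
            ((integrable_const ε).add hi) ?_
          filter_upwards [hC n] with ω hω
          by_cases h' : ε ≤ ‖f n ω - g ω‖
          · rw [Set.indicator_of_mem (by exact h')]
            linarith
          · rw [Set.indicator_of_notMem (by exact h'), add_zero]
            exact (not_le.1 h').le
      _ = ε + C * P.real {ω | ε ≤ ‖f n ω - g ω‖} := by
          rw [integral_add (integrable_const ε) hi, integral_indicator₀ hS, setIntegral_const]
          simp [mul_comm]
  rw [Metric.tendsto_atTop]
  intro ε hε
  have h2 : Tendsto (fun n => ε / 2 + C * P.real {ω | ε / 2 ≤ ‖f n ω - g ω‖}) atTop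
      (𝓝 (ε / 2 + C * 0)) := ((hmeas (ε / 2) (by positivity)).const_mul C).const_add _
  obtain ⟨N, hN⟩ := eventually_atTop.1 (h2.eventually_lt_const (u := ε) (by linarith))
  refine ⟨N, fun n hn => ?_⟩
  rw [Real.dist_eq, sub_zero, abs_of_nonneg (integral_nonneg fun _ => norm_nonneg _)]
  exact (hbound _ (by positivity) n).trans_lt (hN n hn)

/-- Bounded variables measurable for the limit of an increasing sequence of `σ`-fields are limits
in `L¹` of bounded variables measurable for the members of the sequence. -/
lemma exists_adapted_approx {F : ℕ → MeasurableSpace Ω} (hmono : Monotone F)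
    (hle : ∀ n, F n ≤ mΩ) {f : Ω → ℝ} (hf : AEStronglyMeasurable[⨆ n, F n] f P) {C : ℝ}
    (hC : ∀ᵐ ω ∂P, |f ω| ≤ C) :
    ∃ g : ℕ → Ω → ℝ, (∀ n, Measurable[F n] (g n)) ∧ (∀ n, ∀ᵐ ω ∂P, |g n ω| ≤ C) ∧
      Tendsto (fun n => ∫ ω, |g n ω - f ω| ∂P) atTop (𝓝 0) := by
  have hsup : (⨆ n, F n) ≤ mΩ := iSup_le hle
  have hfi : Integrable f P := Integrable.of_bound (hf.mono hsup) C hC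
  let ℱ : Filtration ℕ mΩ := ⟨F, hmono, hle⟩
  refine ⟨fun n => P[f | F n], fun n => stronglyMeasurable_condExp.measurable, fun n => ?_, ?_⟩
  · exact ae_bdd_abs_condExp_of_ae_bdd_abs hC
  · have h := tendsto_eLpNorm_condExp (ℱ := ℱ) (μ := P) f
    have h2 := (ENNReal.tendsto_toReal ENNReal.zero_ne_top).comp h
    rw [ENNReal.toReal_zero] at h2
    refine h2.congr fun n => ?_
    have hs : P[f | ⨆ n, F n] =ᵐ[P] f := condExp_of_aestronglyMeasurable' hsup hf hfi
    have hi : Integrable (P[f | F n] - f) P := integrable_condExp.sub hfi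
    simp only [Function.comp_apply]
    rw [eLpNorm_congr_ae (g := P[f | F n] - f) (EventuallyEq.rfl.sub hs),
      eLpNorm_one_eq_lintegral_enorm, ← integral_norm_eq_lintegral_enorm hi.1]
    rfl

/-- Real and imaginary parts are approximated separately, whence the bound `C + C`. -/
lemma exists_adapted_approx_complex {F : ℕ → MeasurableSpace Ω} (hmono : Monotone F)
    (hle : ∀ n, F n ≤ mΩ) {f : Ω → ℂ} (hf : AEStronglyMeasurable[⨆ n, F n] f P) {C : ℝ}
    (hC : ∀ᵐ ω ∂P, ‖f ω‖ ≤ C) :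
    ∃ g : ℕ → Ω → ℂ, (∀ n, Measurable[F n] (g n)) ∧ (∀ n, ∀ᵐ ω ∂P, ‖g n ω‖ ≤ C + C) ∧
      Tendsto (fun n => ∫ ω, ‖g n ω - f ω‖ ∂P) atTop (𝓝 0) := by
  have hsup : (⨆ n, F n) ≤ mΩ := iSup_le hle
  have hfi : Integrable f P := Integrable.of_bound (hf.mono hsup) C hC
  obtain ⟨a, ham, haC, halim⟩ := exists_adapted_approx (P := P) hmono hle
    (f := fun ω => (f ω).re) (Complex.continuous_re.comp_aestronglyMeasurable hf) (C := C)
    (hC.mono fun ω h => (Complex.abs_re_le_norm _).trans h)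
  obtain ⟨b, hbm, hbC, hblim⟩ := exists_adapted_approx (P := P) hmono hle
    (f := fun ω => (f ω).im) (Complex.continuous_im.comp_aestronglyMeasurable hf) (C := C)
    (hC.mono fun ω h => (Complex.abs_im_le_norm _).trans h)
  have ha : ∀ n, Integrable (a n) P := fun n =>
    Integrable.of_bound ((ham n).mono (hle n) le_rfl).aestronglyMeasurable C (haC n)
  have hb : ∀ n, Integrable (b n) P := fun n =>
    Integrable.of_bound ((hbm n).mono (hle n) le_rfl).aestronglyMeasurable C (hbC n)
  have hnorm : ∀ x y : ℝ, ‖(x : ℂ) + y * Complex.I‖ ≤ |x| + |y| := by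
    intro x y
    refine (norm_add_le _ _).trans ?_
    rw [norm_mul, Complex.norm_I, mul_one, Complex.norm_real, Complex.norm_real]
    exact le_rfl
  refine ⟨fun n ω => a n ω + b n ω * Complex.I, fun n => ?_, fun n => ?_, ?_⟩
  · exact (Complex.measurable_ofReal.comp (ham n)).add
      ((Complex.measurable_ofReal.comp (hbm n)).mul_const _)
  · filter_upwards [haC n, hbC n] with ω h1 h2
    exact (hnorm _ _).trans (add_le_add h1 h2)
  · have hlim := halim.add hblim
    rw [add_zero] at hlim
    refine squeeze_zero (fun n => integral_nonneg fun _ => norm_nonneg _) (fun n => ?_) hlim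
    have i1 : Integrable (fun ω => |a n ω - (f ω).re|) P := ((ha n).sub hfi.re).abs
    have i2 : Integrable (fun ω => |b n ω - (f ω).im|) P := ((hb n).sub hfi.im).abs
    rw [← integral_add i1 i2]
    refine integral_mono_of_nonneg (ae_of_all _ fun _ => norm_nonneg _) (i1.add i2)
      (ae_of_all _ fun ω => ?_)
    have e : (a n ω : ℂ) + b n ω * Complex.I - f ω
        = ((a n ω - (f ω).re : ℝ) : ℂ) + ((b n ω - (f ω).im : ℝ) : ℂ) * Complex.I := by
      conv_lhs => rw [← Complex.re_add_im (f ω)]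
      push_cast
      ring
    exact (congrArg norm e).trans_le (hnorm _ _)

/-- The only place where nonvanishing of the limit is used: at almost every `ω` the indicator is
eventually zero. -/
lemma tendsto_measureReal_norm_le {φ : Ω → ℂ} (hφ : Measurable φ) (hne : ∀ᵐ ω ∂P, φ ω ≠ 0) :
    Tendsto (fun k : ℕ => P.real {ω | ‖φ ω‖ ≤ 2 * ((k : ℝ) + 1)⁻¹}) atTop (𝓝 0) := by
  have hlim : Tendsto (fun k : ℕ => ∫ ω, ({ω | ‖φ ω‖ ≤ 2 * ((k : ℝ) + 1)⁻¹}.indicator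
      (fun _ => (1 : ℝ)) ω) ∂P) atTop (𝓝 (∫ _, (0 : ℝ) ∂P)) := by
    refine tendsto_integral_of_dominated_convergence (fun _ => 1) (fun k => ?_)
      (integrable_const _) (fun k => ae_of_all _ fun ω => ?_) ?_
    · exact (measurable_const.indicator
        (measurableSet_le hφ.norm measurable_const)).aestronglyMeasurable
    · refine (norm_indicator_le_norm_self _ _).trans ?_
      simp
    · filter_upwards [hne] with ω hω
      have h0 : Tendsto (fun k : ℕ => 2 * ((k : ℝ) + 1)⁻¹) atTop (𝓝 0) := by
        have := (tendsto_one_div_add_atTop_nhds_zero_nat (𝕜 := ℝ)).const_mul 2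
        simpa only [one_div, mul_zero] using this
      refine tendsto_const_nhds.congr' ?_
      filter_upwards [h0.eventually_lt_const (norm_pos_iff.2 hω)] with k hk
      rw [Set.indicator_of_notMem]
      simpa using hk
  rw [integral_zero] at hlim
  refine hlim.congr fun k => ?_
  rw [integral_indicator_const _ (measurableSet_le hφ.norm measurable_const)]
  simp

end Limits

/-! ### From the conditioning factor to conditional and stable convergence. -/

section Main

variable {Ω : Type*} {m F : MeasurableSpace Ω} [mΩ : MeasurableSpace Ω] {P : Measure Ω}
  [IsProbabilityMeasure P]
variable {H : Type*} [NormedAddCommGroup H] [InnerProductSpace ℝ H]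
variable {X : H → Ω → ℝ} {π : unitInterval → H →L[ℝ] H}

/-- Test the martingale identity on `ψ` restricted to a set of `m`, which is admissible since `m ≤
F`. -/
lemma condExp_mul_conditioningFactor (hmF : m ≤ F) (hF : F ≤ mΩ)
    {ξ ψ : Ω → ℂ} (hξ : Measurable ξ) {R C : ℝ} (hξR : ∀ ω, ‖ξ ω‖ ≤ R)
    (hmart : ∀ (Z : Ω → ℂ) (C : ℝ), Measurable[F] Z → (∀ᵐ ω ∂P, ‖Z ω‖ ≤ C) →
      ∫ ω, Z ω * ξ ω ∂P = ∫ ω, Z ω ∂P)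
    (hψ : Measurable[m] ψ) (hψC : ∀ᵐ ω ∂P, ‖ψ ω‖ ≤ C) :
    P[fun ω => ψ ω * ξ ω | m] =ᵐ[P] ψ := by
  have hm := hmF.trans hF
  have hψm := hψ.mono hm le_rfl
  have hψi : Integrable ψ P := Integrable.of_bound hψm.aestronglyMeasurable C hψC
  have hi : Integrable (fun ω => ψ ω * ξ ω) P :=
    hψi.mul_bdd hξ.aestronglyMeasurable (ae_of_all _ hξR)
  refine (ae_eq_condExp_of_forall_setIntegral_eq hm hi (fun s _ _ => hψi.integrableOn) ?_
    hψ.stronglyMeasurable.aestronglyMeasurable).symm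
  intro s hs _
  have hmart' := hmart (s.indicator ψ) C ((hψ.indicator hs).mono hmF le_rfl) (by
    filter_upwards [hψC] with ω h
    exact (norm_indicator_le_norm_self _ _).trans h)
  rw [← integral_indicator (hm s hs), ← integral_indicator (hm s hs), ← hmart']
  refine integral_congr_ae (ae_of_all _ fun ω => ?_)
  by_cases h : ω ∈ s <;> simp [h]

/-- Quantitative form of the principle of conditioning. -/
lemma integral_norm_condExp_sub_le (hX : IsIsometricProcess P X) {t : unitInterval}
    (hm : m ≤ resFiltration X π t) {y : Lp H 2 P} {v J : Lp ℝ 2 P}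
    (h : HasConditioningFactor P X π t y v) (lam : ℝ) {δ : ℝ} (hδ : 0 < δ) (hδ1 : δ ≤ 1)
    {φ ψ : Ω → ℂ} (hφ : Measurable φ) (hφ1 : ∀ᵐ ω ∂P, ‖φ ω‖ ≤ 1) (hψ : Measurable[m] ψ) {C : ℝ}
    (hψC : ∀ᵐ ω ∂P, ‖ψ ω‖ ≤ C) :
    ∫ ω, ‖(P[fun ω => Complex.exp ((lam * J ω : ℝ) * Complex.I) | m]) ω - φ ω‖ ∂P
      ≤ |lam| * ‖J - v‖ + (δ⁻¹ + (1 + δ⁻¹) * δ⁻¹) * ∫ ω, ‖chi P X lam (y ω) - φ ω‖ ∂P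
        + 3 * P.real {ω | ‖φ ω‖ ≤ 2 * δ} + (δ⁻¹ + 1) * ∫ ω, ‖ψ ω - φ ω‖ ∂P := by
  obtain ⟨ξ, hξm, hξ, hmart, hfac⟩ := h lam δ hδ hδ1
  have hle : resFiltration X π t ≤ mΩ := sigmaOf_le hX.measurable _
  have hψm := hψ.mono (hm.trans hle) le_rfl
  set W : Ω → ℂ := fun ω => Complex.exp ((lam * J ω : ℝ) * Complex.I) with hW
  have hJ : Integrable J P := (Lp.memLp J).integrable (by norm_num)
  have hv : Integrable v P := (Lp.memLp v).integrable (by norm_num)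
  have hWi : Integrable W P := integrable_exp_mul_I (hJ.1.const_mul lam)
  have hφi : Integrable φ P := Integrable.of_bound hφ.aestronglyMeasurable 1 hφ1
  have hψi : Integrable ψ P := Integrable.of_bound hψm.aestronglyMeasurable C hψC
  have hψξ : Integrable (fun ω => ψ ω * ξ ω) P :=
    hψi.mul_bdd hξm.aestronglyMeasurable (ae_of_all _ hξ)
  have hcond := condExp_mul_conditioningFactor (P := P) hm hle hξm hξ hmart hψ hψC
  -- Since `ψ ξ` has conditional expectation `ψ`, subtracting it before conditioning leaves an error
  -- controlled by the `L¹` contraction property.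
  have hdec : ∀ᵐ ω ∂P, ‖(P[W | m]) ω - φ ω‖
      ≤ ‖(P[W - (fun ω => ψ ω * ξ ω) | m]) ω‖ + ‖ψ ω - φ ω‖ := by
    filter_upwards [hcond, condExp_sub hWi hψξ m] with ω h1 h2
    rw [h2, Pi.sub_apply, h1]
    exact norm_sub_le_norm_sub_add_norm_sub _ _ _
  have hd : Integrable (fun ω => ‖ψ ω - φ ω‖) P := (hψi.sub hφi).norm
  have hchi : Integrable (fun ω => ‖chi P X lam (y ω) - φ ω‖) P := by
    refine ((Integrable.of_bound (C := 1) ?_ (ae_of_all _ fun ω =>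
      norm_chi_le_one hX lam (y ω))).sub hφi).norm
    exact (continuous_chi hX lam).comp_aestronglyMeasurable (Lp.aestronglyMeasurable y)
  have hJv : Integrable (fun ω => ‖J ω - v ω‖) P := (hJ.sub hv).norm
  have hS : MeasurableSet {ω | ‖φ ω‖ ≤ 2 * δ} := measurableSet_le hφ.norm measurable_const
  have hind : Integrable ({ω | ‖φ ω‖ ≤ 2 * δ}.indicator fun _ => (3 : ℝ)) P :=
    (integrable_const _).indicator hS
  set D : ℝ := δ⁻¹ + (1 + δ⁻¹) * δ⁻¹ with hD
  have hδi : 0 < δ⁻¹ := inv_pos.2 hδ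
  have hpt : ∀ᵐ ω ∂P, ‖(W - (fun ω => ψ ω * ξ ω)) ω‖
      ≤ |lam| * ‖J ω - v ω‖ + D * ‖chi P X lam (y ω) - φ ω‖
        + {ω | ‖φ ω‖ ≤ 2 * δ}.indicator (fun _ => (3 : ℝ)) ω + δ⁻¹ * ‖ψ ω - φ ω‖ := by
    filter_upwards [hfac, hφ1] with ω hf h1
    have e1 : ‖W ω - Complex.exp ((lam * v ω : ℝ) * Complex.I)‖ ≤ |lam| * ‖J ω - v ω‖ := by
      refine (norm_exp_mul_I_sub_exp_mul_I_le _ _).trans ?_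
      rw [← mul_sub, abs_mul, Real.norm_eq_abs]
    have e3 : ‖φ ω * ξ ω - ψ ω * ξ ω‖ ≤ δ⁻¹ * ‖ψ ω - φ ω‖ := by
      rw [← sub_mul, norm_mul, norm_sub_rev, mul_comm]
      exact mul_le_mul_of_nonneg_right (hξ ω) (norm_nonneg _)
    -- Three cases. If `|chi| ≥ δ`, the factorization gives `δ⁻¹ r`. If `|chi| < δ` and `|φ| ≤ 2δ`,
    -- the crude bound `1 + |φ| δ⁻¹` is at most `3`. Otherwise `r ≥ δ`, so the crude bound `1 + δ⁻¹`
    -- is at most `(1 + δ⁻¹) δ⁻¹ r`; this is the second term of `D`.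
    have e2 : ‖Complex.exp ((lam * v ω : ℝ) * Complex.I) - φ ω * ξ ω‖
        ≤ D * ‖chi P X lam (y ω) - φ ω‖
          + {ω | ‖φ ω‖ ≤ 2 * δ}.indicator (fun _ => (3 : ℝ)) ω := by
      set r := ‖chi P X lam (y ω) - φ ω‖ with hr
      have hr0 : 0 ≤ r := norm_nonneg _
      have hind0 : 0 ≤ {ω | ‖φ ω‖ ≤ 2 * δ}.indicator (fun _ => (3 : ℝ)) ω :=
        Set.indicator_nonneg (fun _ _ => by norm_num) _
      by_cases hbig : δ ≤ ‖chi P X lam (y ω)‖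
      · rw [hf hbig, mul_comm (φ ω), ← mul_sub, norm_mul]
        have a1 : ‖ξ ω‖ * r ≤ δ⁻¹ * r := mul_le_mul_of_nonneg_right (hξ ω) hr0
        have a2 : 0 ≤ (1 + δ⁻¹) * δ⁻¹ * r := by positivity
        rw [hD, add_mul]
        linarith
      · have a1 : ‖Complex.exp ((lam * v ω : ℝ) * Complex.I) - φ ω * ξ ω‖
            ≤ 1 + ‖φ ω‖ * δ⁻¹ := by
          refine (norm_sub_le _ _).trans ?_
          rw [Complex.norm_exp_ofReal_mul_I, norm_mul]
          gcongr
          exact hξ ω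
        refine a1.trans ?_
        by_cases hsmall : ‖φ ω‖ ≤ 2 * δ
        · rw [Set.indicator_of_mem (by exact hsmall)]
          have a2 : ‖φ ω‖ * δ⁻¹ ≤ 2 := by
            rw [← div_eq_mul_inv, div_le_iff₀ hδ]
            exact hsmall
          have a3 : 0 ≤ D * r := by positivity
          linarith
        · have a2 : δ ≤ r := by
            have := norm_sub_norm_le (φ ω) (chi P X lam (y ω))
            rw [norm_sub_rev] at this
            rw [not_le] at hbig hsmall
            linarith
          have a3 : 1 ≤ δ⁻¹ * r := by
            rw [inv_mul_eq_div, le_div_iff₀ hδ, one_mul]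
            exact a2
          have a4 : 1 + ‖φ ω‖ * δ⁻¹ ≤ 1 + δ⁻¹ := by
            have := mul_le_of_le_one_left hδi.le h1
            linarith
          have a5 : (1 + δ⁻¹) * 1 ≤ (1 + δ⁻¹) * (δ⁻¹ * r) :=
            mul_le_mul_of_nonneg_left a3 (by positivity)
          have a6 : 0 ≤ δ⁻¹ * r := by positivity
          rw [hD, add_mul, mul_assoc]
          linarith
    rw [Pi.sub_apply]
    have e4 := norm_sub_le_norm_sub_add_norm_sub (W ω)
      (Complex.exp ((lam * v ω : ℝ) * Complex.I)) (ψ ω * ξ ω)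
    have e5 := norm_sub_le_norm_sub_add_norm_sub (Complex.exp ((lam * v ω : ℝ) * Complex.I))
      (φ ω * ξ ω) (ψ ω * ξ ω)
    linarith
  have i1 := hJv.const_mul |lam|
  have i2 := hchi.const_mul D
  have i4 := hd.const_mul δ⁻¹
  have i12 : Integrable (fun ω => |lam| * ‖J ω - v ω‖ + D * ‖chi P X lam (y ω) - φ ω‖) P :=
    i1.add i2
  have i123 : Integrable (fun ω => |lam| * ‖J ω - v ω‖ + D * ‖chi P X lam (y ω) - φ ω‖
      + {ω | ‖φ ω‖ ≤ 2 * δ}.indicator (fun _ => (3 : ℝ)) ω) P := i12.add hind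
  have step : ∫ ω, ‖(W - (fun ω => ψ ω * ξ ω)) ω‖ ∂P
      ≤ |lam| * ∫ ω, ‖J ω - v ω‖ ∂P + D * ∫ ω, ‖chi P X lam (y ω) - φ ω‖ ∂P
        + 3 * P.real {ω | ‖φ ω‖ ≤ 2 * δ} + δ⁻¹ * ∫ ω, ‖ψ ω - φ ω‖ ∂P := by
    have i1234 : Integrable (fun ω => |lam| * ‖J ω - v ω‖ + D * ‖chi P X lam (y ω) - φ ω‖
      + {ω | ‖φ ω‖ ≤ 2 * δ}.indicator (fun _ => (3 : ℝ)) ω + δ⁻¹ * ‖ψ ω - φ ω‖) P := i123.add i4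
    refine (integral_mono_of_nonneg (ae_of_all _ fun _ => norm_nonneg _) i1234 hpt).trans
      (le_of_eq ?_)
    rw [integral_add i123 i4, integral_add i12 hind, integral_add i1 i2, integral_const_mul,
      integral_const_mul, integral_const_mul, integral_indicator_const _ hS, smul_eq_mul,
      mul_comm (P.real _)]
  have hJvn := mul_le_mul_of_nonneg_left (integral_norm_sub_le_norm_sub J v) (abs_nonneg lam)
  calc ∫ ω, ‖(P[W | m]) ω - φ ω‖ ∂P
      ≤ ∫ ω, (‖(P[W - (fun ω => ψ ω * ξ ω) | m]) ω‖ + ‖ψ ω - φ ω‖) ∂P :=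
        integral_mono_of_nonneg (ae_of_all _ fun _ => norm_nonneg _)
          (integrable_condExp.norm.add hd) hdec
    _ = ∫ ω, ‖(P[W - (fun ω => ψ ω * ξ ω) | m]) ω‖ ∂P + ∫ ω, ‖ψ ω - φ ω‖ ∂P :=
        integral_add integrable_condExp.norm hd
    _ ≤ ∫ ω, ‖(W - (fun ω => ψ ω * ξ ω)) ω‖ ∂P + ∫ ω, ‖ψ ω - φ ω‖ ∂P := by
        exact add_le_add (integral_norm_condExp_le _) le_rfl
    _ ≤ _ := by
        rw [add_mul δ⁻¹ 1 (∫ ω, ‖ψ ω - φ ω‖ ∂P), one_mul]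
        linarith

/-- Convergence in `L¹` of the conditional characteristic functions implies stable convergence. -/
lemma tendsto_integral_mul_exp {F m : ℕ → MeasurableSpace Ω} (hmono : Monotone F)
    (hFm : ∀ n, F n ≤ m n) (hm : ∀ n, m n ≤ mΩ) {W : ℕ → Ω → ℂ}
    (hWm : ∀ n, AEStronglyMeasurable (W n) P) (hW1 : ∀ n ω, ‖W n ω‖ ≤ 1) {φ : Ω → ℂ}
    (hφm : AEStronglyMeasurable φ P) (hφ1 : ∀ᵐ ω ∂P, ‖φ ω‖ ≤ 1)
    (hlim : Tendsto (fun n => ∫ ω, ‖(P[W n | m n]) ω - φ ω‖ ∂P) atTop (𝓝 0)) {Z : Ω → ℝ}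
    (hZ : AEStronglyMeasurable[⨆ n, F n] Z P) {C : ℝ} (hC : ∀ᵐ ω ∂P, |Z ω| ≤ C) :
    Tendsto (fun n => ∫ ω, (Z ω : ℂ) * W n ω ∂P) atTop (𝓝 (∫ ω, (Z ω : ℂ) * φ ω ∂P)) := by
  have hF : ∀ n, F n ≤ mΩ := fun n => (hFm n).trans (hm n)
  obtain ⟨g, hgm, hgC, hglim⟩ := exists_adapted_approx (P := P) hmono hF hZ hC
  have hWi : ∀ n, Integrable (W n) P := fun n =>
    Integrable.of_bound (hWm n) 1 (ae_of_all _ (hW1 n))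
  have hφi : Integrable φ P := Integrable.of_bound hφm 1 hφ1
  have hZm : AEStronglyMeasurable Z P := hZ.mono (iSup_le hF)
  have hZi : Integrable Z P := Integrable.of_bound hZm C hC
  have hgi : ∀ n, Integrable (g n) P := fun n =>
    Integrable.of_bound ((hgm n).mono (hF n) le_rfl).aestronglyMeasurable C (hgC n)
  have hprod : ∀ {a : Ω → ℝ} {b : Ω → ℂ}, Integrable a P → AEStronglyMeasurable b P →
      (∀ᵐ ω ∂P, ‖b ω‖ ≤ 1) → Integrable (fun ω => (a ω : ℂ) * b ω) P :=
    fun ha hb hb1 => ha.ofReal.mul_bdd hb hb1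
  -- As `g n` is measurable for `m n`, `W n` may be replaced by its conditional expectation.
  have hpull : ∀ n, ∫ ω, (g n ω : ℂ) * W n ω ∂P = ∫ ω, (g n ω : ℂ) * (P[W n | m n]) ω ∂P := by
    intro n
    have hgm' : StronglyMeasurable[m n] (g n) :=
      ((hgm n).mono (hFm n) le_rfl).stronglyMeasurable
    have hint : Integrable (g n • W n) P := by
      refine (hprod (hgi n) (hWm n) (ae_of_all _ (hW1 n))).congr (ae_of_all _ fun ω => ?_)
      simp
    have := condExp_smul_of_aestronglyMeasurable_left (μ := P) hgm'.aestronglyMeasurable hint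
      (hWi n)
    rw [← integral_condExp (hm n) (f := fun ω => (g n ω : ℂ) * W n ω)]
    refine integral_congr_ae ?_
    have e : (fun ω => (g n ω : ℂ) * W n ω) = g n • W n := by
      ext ω
      simp
    rw [e]
    filter_upwards [this] with ω h
    rw [h]
    simp
  have hci : ∀ n, Integrable (fun ω => (g n ω : ℂ) * (P[W n | m n]) ω) P := fun n => by
    refine (integrable_condExp (m := m n) (f := W n) (μ := P)).bdd_mul (c := C)
      (hgi n).ofReal.1 ?_
    filter_upwards [hgC n] with ω h
    simpa using h
  have hbound : ∀ n, ‖∫ ω, (Z ω : ℂ) * W n ω ∂P - ∫ ω, (Z ω : ℂ) * φ ω ∂P‖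
      ≤ 2 * ∫ ω, |g n ω - Z ω| ∂P + C * ∫ ω, ‖(P[W n | m n]) ω - φ ω‖ ∂P := by
    intro n
    have hdiff : Integrable (fun ω => Z ω - g n ω) P := hZi.sub (hgi n)
    have d1 := hprod hdiff (hWm n) (ae_of_all _ (hW1 n))
    have d2 := hprod hdiff hφm hφ1
    have d3 := hprod (hgi n) (hWm n) (ae_of_all _ (hW1 n))
    have d4 := hprod (hgi n) hφm hφ1
    have e1 : ∫ ω, (Z ω : ℂ) * W n ω ∂P
        = ∫ ω, ((Z ω - g n ω : ℝ) : ℂ) * W n ω ∂P + ∫ ω, (g n ω : ℂ) * W n ω ∂P := by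
      rw [← integral_add d1 d3]
      refine integral_congr_ae (ae_of_all _ fun ω => ?_)
      push_cast
      ring
    have e2 : ∫ ω, (Z ω : ℂ) * φ ω ∂P
        = ∫ ω, ((Z ω - g n ω : ℝ) : ℂ) * φ ω ∂P + ∫ ω, (g n ω : ℂ) * φ ω ∂P := by
      rw [← integral_add d2 d4]
      refine integral_congr_ae (ae_of_all _ fun ω => ?_)
      push_cast
      ring
    have b : ∀ {b : Ω → ℂ}, (∀ᵐ ω ∂P, ‖b ω‖ ≤ 1) →
        ‖∫ ω, ((Z ω - g n ω : ℝ) : ℂ) * b ω ∂P‖ ≤ ∫ ω, |g n ω - Z ω| ∂P := by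
      intro b hb
      refine norm_integral_le_of_norm_le ((hgi n).sub hZi).abs ?_
      filter_upwards [hb] with ω h
      rw [norm_mul, Complex.norm_real, Real.norm_eq_abs, abs_sub_comm]
      exact mul_le_of_le_one_right (abs_nonneg _) h
    have b3 : ‖∫ ω, (g n ω : ℂ) * W n ω ∂P - ∫ ω, (g n ω : ℂ) * φ ω ∂P‖
        ≤ C * ∫ ω, ‖(P[W n | m n]) ω - φ ω‖ ∂P := by
      rw [hpull, ← integral_sub (hci n) d4, ← integral_const_mul]
      refine norm_integral_le_of_norm_le
        ((integrable_condExp.sub hφi).norm.const_mul C) ?_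
      filter_upwards [hgC n] with ω h
      rw [← mul_sub, norm_mul, Complex.norm_real]
      exact mul_le_mul_of_nonneg_right h (norm_nonneg _)
    rw [e1, e2, add_sub_add_comm]
    have t1 := norm_add_le (∫ ω, ((Z ω - g n ω : ℝ) : ℂ) * W n ω ∂P
      - ∫ ω, ((Z ω - g n ω : ℝ) : ℂ) * φ ω ∂P)
      (∫ ω, (g n ω : ℂ) * W n ω ∂P - ∫ ω, (g n ω : ℂ) * φ ω ∂P)
    have t2 := norm_sub_le (∫ ω, ((Z ω - g n ω : ℝ) : ℂ) * W n ω ∂P)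
      (∫ ω, ((Z ω - g n ω : ℝ) : ℂ) * φ ω ∂P)
    have t3 := b (ae_of_all _ (hW1 n))
    have t4 := b hφ1
    linarith
  rw [tendsto_iff_norm_sub_tendsto_zero]
  refine squeeze_zero (fun n => norm_nonneg _) hbound ?_
  simpa using (hglim.const_mul 2).add (hlim.const_mul C)

end Main

/-! ### Passage to the limit and conclusion. -/

lemma norm_randomFourier_le_one {Ω : Type*} [MeasurableSpace Ω] (μ : Ω → Measure ℝ) (lam : ℝ)
    (ω : Ω) : ‖randomFourier μ lam ω‖ ≤ 1 := by
  unfold randomFourier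
  split_ifs with h
  · exact norm_charFun_le_one _
  · simp

/-- The conditional characteristic functions of the integrals converge in `L¹`. -/
lemma tendsto_integral_norm_condExp_sub {Ω : Type*} [mΩ : MeasurableSpace Ω] {P : Measure Ω}
    [IsProbabilityMeasure P] {H : Type*} [NormedAddCommGroup H] [InnerProductSpace ℝ H]
    [CompleteSpace H] {X : H → Ω → ℝ} (hX : IsIsometricProcess P X) {Hn : ℕ → Submodule ℝ H}
    {π : ℕ → unitInterval → H →L[ℝ] H} (hπ : ∀ n, IsResolutionFor P X (π n))
    {u : ℕ → Lp H 2 P} (hu : ∀ n, u n ∈ adaptedL2 P X (π n) (Hn n)) {t : ℕ → unitInterval}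
    {U : ℕ → Submodule ℝ H}
    (hneg : Tendsto (fun n => ∫ ω, ‖π n (t n) (u n ω)‖ ^ 2 ∂P) atTop (𝓝 0))
    (hmono : Monotone U) (hUn : ∀ n, U n ≤ projUpTo (π n) (t n) (Hn n)) {lam : ℝ} {φ : Ω → ℂ}
    (hφ : Measurable φ) (hφ1 : ∀ᵐ ω ∂P, ‖φ ω‖ ≤ 1) (hφ0 : ∀ᵐ ω ∂P, φ ω ≠ 0)
    (hφU : AEStronglyMeasurable[⨆ n, sigmaOf X (U n : Set H)] φ P)
    (hconv : TendstoInMeasure P (fun n ω => Complex.exp (psi P X (u n ω) lam)) atTop φ) :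
    Tendsto (fun n => ∫ ω, ‖(P[fun ω => Complex.exp
        ((lam * itoIntegral P X (π n) (u n) ω : ℝ) * Complex.I) |
          sigmaOf X (projUpTo (π n) (t n) (Hn n) : Set H)]) ω - φ ω‖ ∂P) atTop (𝓝 0) := by
  have hnn : ∀ n : ℕ, (0 : ℝ) < 1 / ((n : ℝ) + 1) := fun n => Nat.one_div_pos_of_nat
  have happrox := fun n => exists_elementary_approx hX (hπ n) (hu n) (t n) (hnn n)
  obtain ⟨y, hy⟩ := Classical.axiomOfChoice happrox
  obtain ⟨v, hv⟩ := Classical.axiomOfChoice hy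
  have hdist : Tendsto (fun n => ‖u n - y n‖) atTop (𝓝 0) := by
    have h1 : Tendsto (fun n => ‖(π n (t n)).compLp (u n)‖) atTop (𝓝 0) := by
      have h2 : Tendsto (fun n => ‖(π n (t n)).compLp (u n)‖ ^ 2) atTop (𝓝 0) := by
        refine hneg.congr fun n => ?_
        rw [norm_sq_eq_integral]
        refine integral_congr_ae ?_
        filter_upwards [(π n (t n)).coeFn_compLp (u n)] with ω h
        rw [h]
      have h3 := h2.sqrt
      rw [Real.sqrt_zero] at h3
      exact h3.congr fun n => Real.sqrt_sq (norm_nonneg _)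
    have h2 := h1.add tendsto_one_div_add_atTop_nhds_zero_nat
    rw [add_zero] at h2
    exact squeeze_zero (fun n => norm_nonneg _) (fun n => (hv n).2.2) h2
  have hJ : ∀ n, ‖itoIntegral P X (π n) (u n) - v n‖ = ‖u n - y n‖ := fun n =>
    norm_itoIntegral_sub_le hX (hπ n) (hu n) (hv n).1
  have hchim : ∀ z : Lp H 2 P, AEStronglyMeasurable (fun ω => chi P X lam (z ω)) P := fun z =>
    (continuous_chi hX lam).comp_aestronglyMeasurable (Lp.aestronglyMeasurable z)
  have hchii : ∀ z : Lp H 2 P, Integrable (fun ω => chi P X lam (z ω)) P := fun z =>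
    Integrable.of_bound (hchim z) 1 (ae_of_all _ fun ω => norm_chi_le_one hX lam _)
  have hφi : Integrable φ P := Integrable.of_bound hφ.aestronglyMeasurable 1 hφ1
  have hu_lim : Tendsto (fun n => ∫ ω, ‖chi P X lam (u n ω) - φ ω‖ ∂P) atTop (𝓝 0) := by
    refine tendsto_integral_norm_sub_of_tendstoInMeasure (fun n => hchim _)
      hφ.aestronglyMeasurable (C := 2) (fun n => ?_) ?_
    · filter_upwards [hφ1] with ω h
      have := norm_sub_le (chi P X lam (u n ω)) (φ ω)
      linarith [norm_chi_le_one hX lam (u n ω)]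
    · refine hconv.congr' (Eventually.of_forall fun n => ae_of_all _ fun ω => ?_)
        EventuallyEq.rfl
      exact exp_psi hX (hπ n) lam _
  have hy_lim : Tendsto (fun n => ∫ ω, ‖chi P X lam (y n ω) - φ ω‖ ∂P) atTop (𝓝 0) := by
    have h1 := (hdist.const_mul |lam|).add hu_lim
    rw [mul_zero, add_zero] at h1
    refine squeeze_zero (fun n => integral_nonneg fun _ => norm_nonneg _) (fun n => ?_) h1
    have i1 : Integrable (fun ω => |lam| * ‖u n ω - y n ω‖) P :=
      ((((Lp.memLp (u n)).integrable (by norm_num)).sub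
        ((Lp.memLp (y n)).integrable (by norm_num))).norm).const_mul _
    have i2 : Integrable (fun ω => ‖chi P X lam (u n ω) - φ ω‖) P := ((hchii _).sub hφi).norm
    have h2 : ∫ ω, ‖chi P X lam (y n ω) - φ ω‖ ∂P
        ≤ ∫ ω, (|lam| * ‖u n ω - y n ω‖ + ‖chi P X lam (u n ω) - φ ω‖) ∂P := by
      refine integral_mono_of_nonneg (ae_of_all _ fun _ => norm_nonneg _) (i1.add i2)
        (ae_of_all _ fun ω => ?_)
      refine (norm_sub_le_norm_sub_add_norm_sub _ (chi P X lam (u n ω)) _).trans ?_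
      exact add_le_add ((norm_sub_rev _ _).trans_le (norm_chi_sub_le hX lam _ _)) le_rfl
    rw [integral_add i1 i2, integral_const_mul] at h2
    have h3 := mul_le_mul_of_nonneg_left (integral_norm_sub_le_norm_sub (u n) (y n))
      (abs_nonneg lam)
    linarith
  obtain ⟨ψ, hψm, hψC, hψlim⟩ := exists_adapted_approx_complex (P := P)
    (F := fun n => sigmaOf X (U n : Set H))
    (fun a b hab => sigmaOf_mono (hmono hab)) (fun n => sigmaOf_le hX.measurable _) hφU hφ1
  -- The stopping level `1 / (k + 1)` is independent of `n`: `k` is chosen first to make the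
  -- small-`φ` event negligible, then `n → ∞` kills the terms whose constants blow up with `k`.
  have hest : ∀ (n k : ℕ), _ := fun n k =>
    integral_norm_condExp_sub_le hX (sigmaOf_mono ((hπ n).1.projUpTo_subset (t n) (Hn n)))
      (J := itoIntegral P X (π n) (u n)) (hv n).2.1 lam (δ := ((k : ℝ) + 1)⁻¹) (by positivity)
      (inv_le_one_of_one_le₀ (by linarith [(Nat.cast_nonneg k : (0 : ℝ) ≤ k)]))
      hφ hφ1 ((hψm n).mono (sigmaOf_mono (hUn n)) le_rfl) (hψC n)
  rw [Metric.tendsto_atTop]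
  intro ε hε
  obtain ⟨k, hk⟩ := (((tendsto_measureReal_norm_le (P := P) hφ hφ0).const_mul
    3).eventually_lt_const (u := ε) (by simpa using hε)).exists
  have hbound : Tendsto (fun n => |lam| * ‖itoIntegral P X (π n) (u n) - v n‖
      + (((k : ℝ) + 1)⁻¹⁻¹ + (1 + ((k : ℝ) + 1)⁻¹⁻¹) * ((k : ℝ) + 1)⁻¹⁻¹) *
        ∫ ω, ‖chi P X lam (y n ω) - φ ω‖ ∂P
      + 3 * P.real {ω | ‖φ ω‖ ≤ 2 * ((k : ℝ) + 1)⁻¹}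
      + (((k : ℝ) + 1)⁻¹⁻¹ + 1) * ∫ ω, ‖ψ n ω - φ ω‖ ∂P) atTop
      (𝓝 (3 * P.real {ω | ‖φ ω‖ ≤ 2 * ((k : ℝ) + 1)⁻¹})) := by
    simp only [hJ]
    have := (((hdist.const_mul |lam|).add (hy_lim.const_mul (((k : ℝ) + 1)⁻¹⁻¹ +
      (1 + ((k : ℝ) + 1)⁻¹⁻¹) * ((k : ℝ) + 1)⁻¹⁻¹))).add_const
      (3 * P.real {ω | ‖φ ω‖ ≤ 2 * ((k : ℝ) + 1)⁻¹})).add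
      (hψlim.const_mul (((k : ℝ) + 1)⁻¹⁻¹ + 1))
    simpa only [mul_zero, add_zero, zero_add] using this
  obtain ⟨N, hN⟩ := eventually_atTop.1 (hbound.eventually_lt_const hk)
  refine ⟨N, fun n hn => ?_⟩
  rw [Real.dist_eq, sub_zero, abs_of_nonneg (integral_nonneg fun _ => norm_nonneg _)]
  exact (hest n k).trans_lt (hN n hn)

end StableConv

end

theorem theorem10
    {Ω : Type*} [MeasurableSpace Ω] (P : Measure Ω) [IsProbabilityMeasure P]
    {H : Type*} [NormedAddCommGroup H] [InnerProductSpace ℝ H] [CompleteSpace H]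
    [TopologicalSpace.SeparableSpace H]
    (X : H → Ω → ℝ) (hX : StableConv.IsIsometricProcess P X)
    (Hn : ℕ → Submodule ℝ H) (hHn : ∀ n, IsClosed (Hn n : Set H))
    (π : ℕ → unitInterval → H →L[ℝ] H) (hπ : ∀ n, StableConv.IsResolutionFor P X (π n))
    (u : ℕ → Lp H 2 P) (hu : ∀ n, u n ∈ StableConv.adaptedL2 P X (π n) (Hn n))
    (t : ℕ → unitInterval)
    (U : ℕ → Submodule ℝ H) (hU : ∀ n, IsClosed (U n : Set H))
    (hneg : Tendsto (fun n => ∫ ω, ‖π n (t n) (u n ω)‖ ^ 2 ∂P) atTop (𝓝 0))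
    (hnest : ∀ n, U n ≤ U (n + 1) ⊓ StableConv.projUpTo (π n) (t n) (Hn n))
    (φ : ℝ → Ω → ℂ) (hφ : StableConv.IsNonvanishingRandomCharFun P φ)
    (hφU : ∀ lam : ℝ,
      AEStronglyMeasurable[⨆ n, StableConv.sigmaOf X (U n : Set H)] (φ lam) P)
    (hconv : ∀ lam : ℝ, TendstoInMeasure P
      (fun n ω => Complex.exp (StableConv.psi P X (u n ω) lam)) atTop (φ lam)) :
    (∀ lam : ℝ, TendstoInMeasure P
      (fun n =>
        P[fun ω => Complex.exp
            (Complex.I * lam * (StableConv.itoIntegral P X (π n) (u n) ω : ℝ)) |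
          StableConv.sigmaOf X (StableConv.projUpTo (π n) (t n) (Hn n) : Set H)])
      atTop (φ lam)) ∧
    (∀ μ : Ω → Measure ℝ, StableConv.IsRandomProbability P μ → StableConv.IsFourierOf P φ μ →
      StableConv.StablyConverges P (⨆ n, StableConv.sigmaOf X (U n : Set H))
        (fun n => StableConv.itoIntegral P X (π n) (u n)) μ) := by
  have hexp : ∀ (lam : ℝ) (n : ℕ), (fun ω => Complex.exp
      (Complex.I * lam * (StableConv.itoIntegral P X (π n) (u n) ω : ℝ)))
      = fun ω => Complex.exp
        ((lam * StableConv.itoIntegral P X (π n) (u n) ω : ℝ) * Complex.I) := by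
    intro lam n
    ext ω
    congr 1
    push_cast
    ring
  have hφm : ∀ lam, Measurable (φ lam) := fun lam => hφ.1.1.comp measurable_prodMk_left
  have hφ1 : ∀ lam, ∀ᵐ ω ∂P, ‖φ lam ω‖ ≤ 1 := by
    intro lam
    obtain ⟨μ, -, hμ⟩ := hφ.1.2
    filter_upwards [hμ] with ω h
    rw [h lam]
    exact StableConv.norm_randomFourier_le_one μ lam ω
  have hmono : Monotone U := monotone_nat_of_le_succ fun n => (hnest n).trans inf_le_left
  have hUn : ∀ n, U n ≤ StableConv.projUpTo (π n) (t n) (Hn n) := fun n =>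
    (hnest n).trans inf_le_right
  have hL1 := fun lam => StableConv.tendsto_integral_norm_condExp_sub hX hπ hu hneg hmono hUn
    (hφm lam) (hφ1 lam) (hφ.2.mono fun ω h => h lam) (hφU lam) (hconv lam)
  refine ⟨fun lam => ?_, fun μ _ hμ lam Z hZ hZC => ?_⟩
  · simp only [hexp]
    exact StableConv.tendstoInMeasure_of_tendsto_integral_norm_sub (fun n => integrable_condExp)
      (Integrable.of_bound (hφm lam).aestronglyMeasurable 1 (hφ1 lam)) (hL1 lam)
  · obtain ⟨C, hC⟩ := hZC
    have hlim := StableConv.tendsto_integral_mul_exp (P := P)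
      (F := fun n => StableConv.sigmaOf X (U n : Set H))
      (m := fun n => StableConv.sigmaOf X (StableConv.projUpTo (π n) (t n) (Hn n) : Set H))
      (fun a b hab => StableConv.sigmaOf_mono (hmono hab))
      (fun n => StableConv.sigmaOf_mono (hUn n))
      (fun n => StableConv.sigmaOf_le hX.measurable _)
      (fun n => (StableConv.integrable_exp_mul_I
        ((Lp.aestronglyMeasurable _).const_mul lam)).1)
      (fun n ω => (Complex.norm_exp_ofReal_mul_I _).le)
      (hφm lam).aestronglyMeasurable (hφ1 lam) (hL1 lam) hZ hC
    have e : ∫ ω, (Z ω : ℂ) * φ lam ω ∂P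
        = ∫ ω, (Z ω : ℂ) * StableConv.randomFourier μ lam ω ∂P := by
      refine integral_congr_ae ?_
      filter_upwards [hμ] with ω h
      rw [h lam]
    rw [e] at hlim
    refine hlim.congr fun n => ?_
    refine integral_congr_ae (ae_of_all _ fun ω => ?_)
    exact congrArg _ (congrFun (hexp lam n) ω).symm
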